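/- Let $a,b$ be integers with $b\ge 2$ and $1\le a\le b-1$. Define words over $\{0,1\}$ by $B_0=0$ and $$B_{k+1}=B_k^{\,a b^k}\,1\,B_k^{\,(b-a)b^k}\qquad(k\ge 0).$$ Let $X\subset\{0,1\}^{\mathbb Z}$ be the set of two-sided sequences all of whose finite words $x_m\cdots x_{m+l-1}$ occur as consecutive letters of some $B_k$, equipped with the $\sigma$-algebra generated by the cylinder sets, and let $T:X\to X$, $(Tx)_n=x_{n+1}$, be the left shift (a generalized del Junco–Rudolph map). For a word $w$ let $d_k(w)$ be the density of the occurrences of $w$ in the periodic sequence $\cdots B_kB_kB_k\cdots$. **Theorem.** There is a unique $T$-invariant probability measure $\mu$ on $X$; it satisfies $\mu(\{x\in X: x_j\cdots x_{j+l-1}=w\})=\lim_{k\to\infty}d_k(w)$ for every word $w$ of length $l$ and every $j\in\mathbb Z$ (the limit exists). The system $(X,\mu,T)$ is totally rank one, that is, $T^q$ is rank one for every integer $q\ge 1$. Here an invertible bimeasurable measure-preserving transformation $S$ of a probability space $(X,\mu)$ is called rank one if there are measurable sets $F_m$ and integers $h_m\ge1$ ($m\in\mathbb N$) such that, for each $m$,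 the levels $F_m, SF_m,\dots,S^{h_m-1}F_m$ are pairwise disjoint (a Rokhlin tower), $\mu\bigl(X\setminus\bigcup_{i<h_m}S^iF_m\bigr)\to0$, and for every finite measurable partition $P=(P_1,\dots,P_n)$ of $X$ and every $\varepsilon>0$ there is, for all sufficiently large $m$, a measurable partition $P'=(P'_1,\dots,P'_n)$ (empty pieces being allowed) with $\sum_i\mu(P_i\,\triangle\,P'_i)<\varepsilon$ such that each of the sets $F_m,\dots,S^{h_m-1}F_m$ and $X\setminus\bigcup_{i<h_m}S^iF_m$ is contained in a single piece of $P'$. -/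

import Mathlib

open MeasureTheory Filter Topology
open scoped symmDiff

/-! ### Rank one transformations -/

section RankOne

variable {α : Type*} [MeasurableSpace α]

/-- A finite measurable partition of `α`, as an indexed family of pairwise disjoint measurable sets
covering `α` (some of the pieces may be empty). -/
structure IsMeasurablePartition {n : ℕ} (P : Fin n → Set α) : Prop where
  measurableSet : ∀ i, MeasurableSet (P i)
  disjoint : Pairwise fun i j => Disjoint (P i) (P j)
  iUnion_eq : ⋃ i, P i = Set.univ

/-- The union `F ∪ T F ∪ ⋯ ∪ T^{h-1} F` of the levels of the tower with base `F` and height `h`. -/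
def towerUnion (T : α → α) (F : Set α) (h : ℕ) : Set α :=
  ⋃ i ∈ Set.Iio h, T^[i] '' F

/-- `F` is the base of a Rokhlin tower of height `h ≥ 1` for the invertible transformation `T`:
the levels `F, T F, …, T^{h-1} F` are measurable and pairwise disjoint. -/
structure IsRokhlinTower (T : α → α) (F : Set α) (h : ℕ) : Prop where
  height_pos : 0 < h
  measurableSet : ∀ i < h, MeasurableSet (T^[i] '' F)
  disjoint : (Set.Iio h).PairwiseDisjoint fun i => T^[i] '' F

/-- The partition of `α` into the levels of the tower with base `F` and height `h`, together with
the complement of the tower, refines `P`: each of its pieces lies in a piece of `P`. -/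
def TowerRefines {n : ℕ} (T : α → α) (F : Set α) (h : ℕ) (P : Fin n → Set α) : Prop :=
  (∀ i < h, ∃ j, T^[i] '' F ⊆ P j) ∧ ∃ j, (towerUnion T F h)ᶜ ⊆ P j

/-- The invertible transformation `T` of the finite measure space `(α, μ)` is rank one: there is
a sequence of Rokhlin towers, exhausting the space in measure, such that every finite measurable
partition `P` is approximated by partitions `P'` that the towers refine, in the distance
`∑ i, μ (P i ∆ P' i)`. -/
def IsRankOne (μ : Measure α) (T : α → α) : Prop :=
  ∃ (F : ℕ → Set α) (h : ℕ → ℕ),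
    (∀ m, IsRokhlinTower T (F m) (h m)) ∧
    Tendsto (fun m => μ (towerUnion T (F m) (h m))ᶜ) atTop (𝓝 0) ∧
    ∀ (n : ℕ) (P : Fin n → Set α), IsMeasurablePartition P →
      ∀ ε : ENNReal, 0 < ε → ∀ᶠ m in atTop, ∃ P' : Fin n → Set α,
        IsMeasurablePartition P' ∧ TowerRefines T (F m) (h m) P' ∧
          ∑ i, μ (P i ∆ P' i) < ε

/-- All positive powers of `T` are rank one. -/
def IsTotallyRankOne (μ : Measure α) (T : α → α) : Prop :=
  ∀ q : ℕ, 0 < q → IsRankOne μ T^[q]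

end RankOne

/-! ### Generalized del Junco–Rudolph maps -/

namespace DelJuncoRudolph

/-- The blocks `B₀ = 0`, `B_{k+1} = B_k^{a b^k} 1 B_k^{(b-a) b^k}`, for `1 ≤ a < b`. -/
def block (a b : ℕ) : ℕ → List (Fin 2)
  | 0 => [0]
  | k + 1 => (List.replicate (a * b ^ k) (block a b k)).flatten ++
      [1] ++ (List.replicate ((b - a) * b ^ k) (block a b k)).flatten

/-- The word `x_m x_{m+1} ⋯ x_{m+l-1}`. -/
def window (x : ℤ → Fin 2) (m : ℤ) (l : ℕ) : List (Fin 2) :=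
  List.ofFn fun i : Fin l => x (m + (i : ℕ))

/-- The two-sided sequences all of whose finite words occur in some block. -/
def subshift (a b : ℕ) : Set (ℤ → Fin 2) :=
  {x | ∀ (m : ℤ) (l : ℕ), ∃ k, window x m l <:+: block a b k}

theorem translate_mem {a b : ℕ} {x : ℤ → Fin 2} (hx : x ∈ subshift a b) (c : ℤ) :
    (fun n => x (n + c)) ∈ subshift a b := by
  intro m l
  obtain ⟨k, hk⟩ := hx (m + c) l
  refine ⟨k, ?_⟩
  have h : window (fun n => x (n + c)) m l = window x (m + c) l := by
    unfold window
    congr 1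
    funext i
    exact congrArg x (add_right_comm m _ c)
  rwa [h]

/-- The generalized del Junco–Rudolph map with parameters `a`, `b`: the left shift
`(T x)_n = x_{n+1}` on the subshift. The measurable sets of the subshift are those of the
product σ-algebra, that is, the σ-algebra generated by the cylinder sets. -/
def shift (a b : ℕ) : subshift a b ≃ᵐ subshift a b where
  toFun x := ⟨fun n => x.1 (n + 1), translate_mem x.2 1⟩
  invFun x := ⟨fun n => x.1 (n + -1), translate_mem x.2 (-1)⟩
  left_inv x := by
    apply Subtype.ext
    funext n
    simp
  right_inv x := by
    apply Subtype.ext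
    funext n
    simp
  measurable_toFun := by
    refine Measurable.subtype_mk (measurable_pi_lambda _ fun n => ?_)
    exact (measurable_pi_apply (n + 1)).comp measurable_subtype_coe
  measurable_invFun := by
    refine Measurable.subtype_mk (measurable_pi_lambda _ fun n => ?_)
    exact (measurable_pi_apply (n + -1)).comp measurable_subtype_coe

/-- The cylinder set with name `w` at position `j`. -/
def cylinder (a b : ℕ) (w : List (Fin 2)) (j : ℤ) : Set (subshift a b) :=
  {x | window x.1 j w.length = w}

/-- The periodic two-sided sequence `⋯ B_k B_k B_k ⋯`, with a copy of `B_k` starting at `0`. -/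
def periodicBlock (a b k : ℕ) : ℤ → Fin 2 :=
  fun n => (block a b k).getD (n % ((block a b k).length : ℤ)).toNat 0

/-- The density `d_k(w)` of the occurrences of the word `w` in `⋯ B_k B_k B_k ⋯`, computed over
one period. -/
noncomputable def density (a b : ℕ) (w : List (Fin 2)) (k : ℕ) : ℝ :=
  (((Finset.range (block a b k).length).filter
      fun i : ℕ => window (periodicBlock a b k) (i : ℤ) w.length = w).card : ℝ) /
    ((block a b k).length : ℝ)

end DelJuncoRudolph

/-!
# Total rank one for the generalized del Junco–Rudolph maps

**Unique ergodicity.** Every point of the subshift is, for each `K`, a concatenation of copies of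
`B_K` with at most one letter between consecutive copies (`exists_tiling`). Hence a lower
bound `c` for the number of visits to a set `G` along any copy of `B_K` gives
`c / (|B_K| + 1) ≤ ν G` for every invariant probability measure `ν` (`div_le_measureReal`). Applied
to a cylinder and to its complement, this bounds the distance from the measure of the cylinder to
the density `d_k(w)` by `(|w| + 1) / (|B_k| + 1)`: the densities converge, and their limits determine
the measure. An invariant measure exists as a limit point of the uniform measures on the orbits of
`⋯ B_k B_k B_k ⋯`.

**Rank one.** The length of `B_k` is prime to `b` and the number of its zeros is a power of `b`, so
`B_k` is a primitive word and two long overlapping runs of `B_k` are in phase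
(`IsBlockRun.length_dvd`). Given `q`, infinitely many `k` satisfy `gcd (|B_k|, q) = 1`
(`exists_coprime_length_block`). For such `k`, let `F` be the set of points that read `q + 1` copies
of `B_k` from the origin on. In a run of copies of `B_k`, steps of length `q` pass through all
residues modulo `|B_k|` in `|B_k|` steps, so the first `|B_k|` images of `F` under the `q`-th power of
the shift are disjoint, and they contain every position of the run except those near its
ends. As `B_{k+1}` consists of two long runs of `B_k`, the ergodic estimate shows that these towers
fill the space. A letter at a fixed position is constant on all levels but a bounded number of
them, and the sets approximated by unions of levels form a σ-algebra, so every measurable set is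
approximated.
-/

namespace DelJuncoRudolph

variable {a b : ℕ}

/-! ### Lengths and letters of the blocks -/

theorem length_block_succ (hab : a ≤ b) (k : ℕ) :
    (block a b (k + 1)).length = b ^ (k + 1) * (block a b k).length + 1 := by
  obtain ⟨c, rfl⟩ := Nat.exists_eq_add_of_le hab
  simp only [block, List.length_append, List.length_flatten, List.map_replicate,
    List.sum_replicate, smul_eq_mul, List.length_singleton, Nat.add_sub_cancel_left]
  ring

theorem length_block_pos (hab : a ≤ b) (k : ℕ) : 0 < (block a b k).length := by
  cases k with
  | zero => simp [block]
  | succ k => rw [length_block_succ hab]; omega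

theorem coprime_length_block (hab : a ≤ b) (k : ℕ) : Nat.Coprime (block a b k).length b := by
  cases k with
  | zero => simp [block]
  | succ k =>
    rw [length_block_succ hab, pow_succ', mul_assoc]
    simp

theorem exists_count_block (hab : a ≤ b) (k : ℕ) : ∃ e, (block a b k).count 0 = b ^ e := by
  induction k with
  | zero => exact ⟨0, by simp [block]⟩
  | succ k ih =>
    obtain ⟨e, he⟩ := ih
    refine ⟨k + 1 + e, ?_⟩
    obtain ⟨c, rfl⟩ := Nat.exists_eq_add_of_le hab
    simp only [block, List.count_append, List.count_flatten, List.map_replicate,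
      List.sum_replicate, smul_eq_mul, he, Nat.add_sub_cancel_left]
    simp
    ring

/-- The number of zeros of a block is a power of `b`, while its length is prime to `b`. -/
theorem coprime_length_count (hab : a ≤ b) (k : ℕ) :
    Nat.Coprime (block a b k).length ((block a b k).count 0) := by
  obtain ⟨e, he⟩ := exists_count_block hab k
  rw [he]
  exact (coprime_length_block hab k).pow_right e

theorem tendsto_length_block (hab : a ≤ b) (hb : 2 ≤ b) :
    Tendsto (fun k => (block a b k).length) atTop atTop := by
  refine tendsto_atTop_mono (fun k => ?_) tendsto_id
  induction k with
  | zero => simp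
  | succ k ih =>
    rw [length_block_succ hab]
    have : 1 ≤ b ^ (k + 1) := Nat.one_le_pow _ _ (by omega)
    simp only [id] at ih ⊢
    nlinarith

theorem periodicBlock_natCast (k i : ℕ) :
    periodicBlock a b k i = (block a b k).getD (i % (block a b k).length) 0 := by
  simp only [periodicBlock]
  congr 1

theorem periodicBlock_add_length (k : ℕ) (n : ℤ) :
    periodicBlock a b k (n + (block a b k).length) = periodicBlock a b k n := by
  simp [periodicBlock]

theorem periodicBlock_add_mul_length (k : ℕ) (n : ℤ) (j : ℤ) :
    periodicBlock a b k (n + j * (block a b k).length) = periodicBlock a b k n := by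
  simp [periodicBlock]

theorem periodicBlock_natCast_of_lt {k i : ℕ} (hi : i < (block a b k).length) :
    periodicBlock a b k i = (block a b k).getD i 0 := by
  rw [periodicBlock_natCast, Nat.mod_eq_of_lt hi]

theorem sum_range_mul_of_periodic {f : ℕ → ℕ} {p : ℕ} (hf : ∀ n, f (n + p) = f n) (m : ℕ) :
    ∑ i ∈ Finset.range (m * p), f i = m * ∑ i ∈ Finset.range p, f i := by
  induction m with
  | zero => simp
  | succ m ih =>
    have h : ∀ i, f (m * p + i) = f i := by
      intro i
      clear ih
      induction m with
      | zero => simp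
      | succ m ih => rw [← ih, ← hf (m * p + i)]; congr 1; ring
    rw [add_mul, one_mul, Finset.sum_range_add, ih]
    simp only [h]
    ring

theorem count_eq_sum (l : List (Fin 2)) :
    l.count 0 = ∑ i ∈ Finset.range l.length, if l.getD i 0 = 0 then 1 else 0 := by
  induction l with
  | nil => simp
  | cons c l ih =>
    rw [List.length_cons, Finset.sum_range_succ', List.count_cons, ih]
    simp

/-- The blocks are primitive words: every period of `⋯ B_k B_k B_k ⋯` is a multiple of the length
of `B_k`. Counting zeros on an interval of length `D * |B_k|` in two ways, `|B_k|` divides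
`D` times the number of zeros of `B_k`, which is prime to `|B_k|`. -/
theorem length_dvd_of_periodic (hab : a ≤ b) {k D : ℕ}
    (hD : ∀ n : ℕ, periodicBlock a b k (n + D : ℕ) = periodicBlock a b k n) :
    (block a b k).length ∣ D := by
  set f : ℕ → ℕ := fun n => if periodicBlock a b k n = 0 then 1 else 0 with hf
  have h1 := sum_range_mul_of_periodic (f := f) (p := D) (fun n => by simp only [hf, hD])
    (block a b k).length
  have h2 := sum_range_mul_of_periodic (f := f) (p := (block a b k).length) (fun n => by
    simp only [hf]
    rw [Nat.cast_add, periodicBlock_add_length]) D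
  have h3 : ∑ i ∈ Finset.range (block a b k).length, f i = (block a b k).count 0 := by
    rw [count_eq_sum]
    refine Finset.sum_congr rfl fun i hi => ?_
    simp only [hf]
    rw [periodicBlock_natCast_of_lt (Finset.mem_range.1 hi)]
  rw [mul_comm, h2, h3] at h1
  exact (coprime_length_count hab k).dvd_of_dvd_mul_right ⟨_, h1⟩

theorem getD_flatten_replicate (l : List (Fin 2)) (n i : ℕ) (hi : i < n * l.length) :
    (List.replicate n l).flatten.getD i 0 = l.getD (i % l.length) 0 := by
  induction n generalizing i with
  | zero => simp at hi
  | succ n ih =>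
    rw [List.replicate_succ, List.flatten_cons]
    by_cases h : i < l.length
    · rw [List.getD_append _ _ _ _ h, Nat.mod_eq_of_lt h]
    · push Not at h
      rw [List.getD_append_right _ _ _ _ h, ih, Nat.mod_eq_sub_mod h]
      rw [add_mul] at hi
      omega

/-! ### Runs of a block -/

/-- The sequence `x` reads the first `n` letters of `B_k B_k B_k ⋯` from position `s` on. -/
def IsBlockRun (a b k : ℕ) (x : ℤ → Fin 2) (s : ℤ) (n : ℕ) : Prop :=
  ∀ i < n, x (s + (i : ℕ)) = periodicBlock a b k (i : ℕ)

theorem window_eq_iff (x : ℤ → Fin 2) (m : ℤ) (w : List (Fin 2)) :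
    window x m w.length = w ↔ ∀ i < w.length, x (m + (i : ℕ)) = w.getD i 0 := by
  constructor
  · intro h i hi
    have : (window x m w.length).getD i 0 = w.getD i 0 := by rw [h]
    rw [← this, window, List.getD_eq_getElem _ _ (by simpa using hi)]
    simp
  · intro h
    refine List.ext_getElem (by simp [window]) fun i h1 h2 => ?_
    have := h i h2
    rw [List.getD_eq_getElem _ _ h2] at this
    simp [window, this]

theorem IsBlockRun.sub {k : ℕ} {x : ℤ → Fin 2} {s : ℤ} {n : ℕ} (h : IsBlockRun a b k x s n)
    {i m : ℕ} (him : i * (block a b k).length + m ≤ n) :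
    IsBlockRun a b k x (s + i * (block a b k).length) m := by
  intro j hj
  have := h (i * (block a b k).length + j) (by omega)
  push_cast at this
  rw [add_assoc, this, add_comm, periodicBlock_add_mul_length]

/-- Two overlapping runs of `B_k` whose common part has at least the length of `B_k` are in phase. -/
theorem IsBlockRun.length_dvd (hab : a ≤ b) {k : ℕ} {x : ℤ → Fin 2} {s : ℤ} {n D : ℕ}
    (h1 : IsBlockRun a b k x s n) (h2 : IsBlockRun a b k x (s + D) n)
    (hn : D + (block a b k).length ≤ n) : (block a b k).length ∣ D := by
  refine length_dvd_of_periodic hab fun m => ?_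
  have hpos := length_block_pos hab k
  have hlt := Nat.mod_lt m hpos
  have h3 := h1 (m % (block a b k).length + D) (by omega)
  have h4 := h2 (m % (block a b k).length) (by omega)
  have h5 : periodicBlock a b k (m + D : ℕ)
      = periodicBlock a b k (m % (block a b k).length + D : ℕ) := by
    rw [periodicBlock_natCast, periodicBlock_natCast]; simp
  have h6 : periodicBlock a b k m = periodicBlock a b k (m % (block a b k).length : ℕ) := by
    rw [periodicBlock_natCast, periodicBlock_natCast]; simp
  rw [h5, h6, ← h3, ← h4]
  congr 1
  push_cast
  ring

theorem IsBlockRun.of_succ {k : ℕ} {x : ℤ → Fin 2} {s : ℤ}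
    (h : IsBlockRun a b (k + 1) x s (block a b (k + 1)).length) :
    IsBlockRun a b k x s (a * b ^ k * (block a b k).length) ∧
    IsBlockRun a b k x (s + (a * b ^ k * (block a b k).length + 1 : ℕ))
      ((b - a) * b ^ k * (block a b k).length) := by
  have hlen : (block a b (k + 1)).length = a * b ^ k * (block a b k).length + 1 +
      (b - a) * b ^ k * (block a b k).length := by
    simp [block]
    ring
  have hl : ∀ n, (List.replicate n (block a b k)).flatten.length = n * (block a b k).length := by
    intro n; simp
  constructor
  · intro i hi
    rw [h i (by omega), periodicBlock_natCast_of_lt (by omega), periodicBlock_natCast, block,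
      List.append_assoc, List.getD_append _ _ _ _ (by rw [hl]; omega),
      getD_flatten_replicate _ _ _ hi]
  · intro i hi
    rw [add_assoc, ← Nat.cast_add, h _ (by omega), periodicBlock_natCast_of_lt (by omega),
      periodicBlock_natCast, block, List.getD_append_right _ _ _ _ (by simp)]
    have : ((List.replicate (a * b ^ k) (block a b k)).flatten ++ [1]).length =
        a * b ^ k * (block a b k).length + 1 := by simp
    rw [this, Nat.add_sub_cancel_left, getD_flatten_replicate _ _ _ hi]

/-! ### Tilings by a block -/

/-- The words that are concatenations of copies of `B`, with at most one letter `1` inserted between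
any two consecutive copies. -/
def IsTiled (B w : List (Fin 2)) : Prop :=
  ∃ l : List (List (Fin 2)), (∀ p ∈ l, p = B ∨ p = B ++ [1]) ∧ w = l.flatten ++ B

theorem IsTiled.append {B v w : List (Fin 2)} (hv : IsTiled B v) (hw : IsTiled B w) :
    IsTiled B (v ++ w) := by
  obtain ⟨l, hl, rfl⟩ := hv
  obtain ⟨m, hm, rfl⟩ := hw
  refine ⟨l ++ [B] ++ m, ?_, by simp⟩
  intro p hp
  simp only [List.mem_append, List.mem_singleton] at hp
  rcases hp with (h | h) | h
  exacts [hl p h, Or.inl h, hm p h]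

theorem IsTiled.append_one_append {B v w : List (Fin 2)} (hv : IsTiled B v) (hw : IsTiled B w) :
    IsTiled B (v ++ [1] ++ w) := by
  obtain ⟨l, hl, rfl⟩ := hv
  obtain ⟨m, hm, rfl⟩ := hw
  refine ⟨l ++ [B ++ [1]] ++ m, ?_, by simp⟩
  intro p hp
  simp only [List.mem_append, List.mem_singleton] at hp
  rcases hp with (h | h) | h
  exacts [hl p h, Or.inr h, hm p h]

theorem IsTiled.replicate {B v : List (Fin 2)} (hv : IsTiled B v) {n : ℕ} (hn : 0 < n) :
    IsTiled B (List.replicate n v).flatten := by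
  induction n, hn using Nat.le_induction with
  | base => simpa using hv
  | succ n hn ih => rw [List.replicate_succ, List.flatten_cons]; exact hv.append ih

theorem isTiled_block (ha : 1 ≤ a) (hab : a < b) {k m : ℕ} (hkm : k ≤ m) :
    IsTiled (block a b k) (block a b m) := by
  induction m, hkm using Nat.le_induction with
  | base => exact ⟨[], by simp, by simp⟩
  | succ m hkm ih =>
    have hb : 0 < b ^ m := Nat.pow_pos (by omega)
    exact (ih.replicate (Nat.mul_pos ha hb)).append_one_append
      (ih.replicate (Nat.mul_pos (Nat.sub_pos_of_lt hab) hb))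

theorem block_infix_block (ha : 1 ≤ a) (hab : a < b) {k m : ℕ} (hkm : k ≤ m) :
    block a b k <:+: block a b m := by
  obtain ⟨l, -, h⟩ := isTiled_block ha hab hkm
  exact ⟨l.flatten, [], by rw [h]; simp⟩

theorem isBlockRun_length_iff {k : ℕ} {x : ℤ → Fin 2} {s : ℤ} :
    IsBlockRun a b k x s (block a b k).length ↔
      ∀ i < (block a b k).length, x (s + (i : ℕ)) = (block a b k).getD i 0 :=
  forall₂_congr fun i hi => by rw [periodicBlock_natCast_of_lt hi]

theorem length_flatten_take_succ (l : List (List (Fin 2))) {i : ℕ} (hi : i < l.length) :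
    (l.take (i + 1)).flatten.length = (l.take i).flatten.length + l[i].length := by
  rw [List.take_succ_eq_append_getElem hi, List.flatten_append, List.length_append]
  simp

theorem getD_flatten_take_add {B : List (Fin 2)} {l : List (List (Fin 2))}
    (hl : ∀ p ∈ l, p = B ∨ p = B ++ [1]) {i j : ℕ} (hi : i < l.length) (hj : j < B.length) :
    (l.flatten ++ B).getD ((l.take i).flatten.length + j) 0 = B.getD j 0 := by
  have h : l.flatten = (l.take i).flatten ++ (l[i] ++ (l.drop (i + 1)).flatten) := by
    rw [← List.flatten_cons, ← List.drop_eq_getElem_cons hi, ← List.flatten_append,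
      List.take_append_drop]
  rw [h, List.append_assoc, List.append_assoc,
    List.getD_append_right _ _ _ _ (by simp), Nat.add_sub_cancel_left]
  rcases hl l[i] (List.getElem_mem hi) with h | h
  · rw [h, List.getD_append _ _ _ _ hj]
  · rw [h, List.append_assoc, List.getD_append _ _ _ _ hj]

/-- Every point of the subshift is, from some early position on and for as long as wanted, a
concatenation of copies of `B_K` with at most one letter between consecutive copies. -/
theorem exists_tiling (ha : 1 ≤ a) (hab : a < b) (K L : ℕ) {x : ℤ → Fin 2}
    (hx : x ∈ subshift a b) :
    ∃ t : ℕ → ℕ, t 0 ≤ (block a b K).length ∧ ∀ i < L,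
      (block a b K).length ≤ t (i + 1) - t i ∧ t (i + 1) ≤ t i + (block a b K).length + 1 ∧
      IsBlockRun a b K x (t i) (block a b K).length := by
  set H := (block a b K).length with hH
  -- A window long enough for a partial tile at the start and `L` full tiles, followed by another.
  obtain ⟨N, hN⟩ : ∃ N, N = (L + 2) * (H + 1) := ⟨_, rfl⟩
  obtain ⟨m₀, hm₀⟩ := hx 0 N
  obtain ⟨P, S, hPS⟩ := hm₀.trans (block_infix_block ha hab (le_max_left m₀ K))
  obtain ⟨l, hl, hlB⟩ := isTiled_block ha hab (le_max_right m₀ K)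
  set B := block a b K with hB
  have hlen : ∀ i (hi : i < l.length), H ≤ l[i].length ∧ l[i].length ≤ H + 1 := by
    intro i hi
    rcases hl l[i] (List.getElem_mem hi) with h | h <;> rw [h] <;> simp [hH]
  have hxB : ∀ j : ℕ, j < N → x j = (l.flatten ++ B).getD (P.length + j) 0 := by
    intro j hj
    rw [← hlB, ← hPS, List.append_assoc, List.getD_append_right _ _ _ _ (by simp),
      Nat.add_sub_cancel_left, List.getD_append _ _ _ _ (by simpa [window] using hj),
      List.getD_eq_getElem _ _ (by simpa [window] using hj)]
    simp [window]
  -- `u i` is the boundary before the `i`-th tile, counted from the start of the large block;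
  -- the window starts at `P.length`.
  set u : ℕ → ℕ := fun i => (l.take i).flatten.length with hu
  have hu1 : ∀ i, i < l.length → u i + H ≤ u (i + 1) := fun i hi => by
    simp only [hu, length_flatten_take_succ l hi]
    have := hlen i hi
    omega
  have hu2 : ∀ i, u (i + 1) ≤ u i + H + 1 := fun i => by
    by_cases hi : i < l.length
    · simp only [hu, length_flatten_take_succ l hi]
      have := hlen i hi
      omega
    · simp only [hu]
      rw [List.take_of_length_le (by omega), List.take_of_length_le (by omega)]
      omega
  have hu3 : ∀ i, l.length ≤ i → P.length + N ≤ u i + H := fun i hi => by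
    simp only [hu]
    rw [List.take_of_length_le hi]
    have := congrArg List.length (hPS.trans hlB)
    simp only [List.length_append, window, List.length_ofFn] at this
    omega
  have hNH : H ≤ N := by rw [hN]; nlinarith
  have hex : ∃ i, P.length ≤ u i := ⟨l.length, by have := hu3 _ le_rfl; omega⟩
  set i₀ := Nat.find hex with hi₀
  have h0 : P.length ≤ u i₀ := Nat.find_spec hex
  have h0' : u i₀ ≤ P.length + H := by
    rcases Nat.eq_zero_or_pos i₀ with h | h
    · rw [h]; simp [hu]
    · have h1 : ¬ P.length ≤ u (i₀ - 1) := Nat.find_min hex (by omega)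
      have h2 := hu2 (i₀ - 1)
      rw [Nat.sub_add_cancel h] at h2
      omega
  have hup : ∀ i, u (i₀ + i) ≤ P.length + H + i * (H + 1) := by
    intro i
    induction i with
    | zero => simpa using h0'
    | succ i ih =>
      have := hu2 (i₀ + i)
      rw [← add_assoc, add_mul]
      omega
  have hlow : ∀ i < L, i₀ + i < l.length := by
    intro i hi
    by_contra! h
    have h1 := hu3 _ h
    have h2 := hup i
    have h3 : i * (H + 1) ≤ L * (H + 1) := Nat.mul_le_mul_right _ hi.le
    rw [hN, add_mul] at h1
    omega
  have hmono : ∀ i ≤ L, P.length ≤ u (i₀ + i) := by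
    intro i hi
    induction i with
    | zero => simpa using h0
    | succ i ih =>
      have := hu1 (i₀ + i) (hlow i (by omega))
      have := ih (by omega)
      rw [← add_assoc]
      omega
  refine ⟨fun i => u (i₀ + i) - P.length, by beta_reduce; rw [add_zero]; omega, fun i hi => ?_⟩
  have h1 := hu1 (i₀ + i) (hlow i hi)
  have h2 := hu2 (i₀ + i)
  have h3 := hmono i hi.le
  have h4 := hup i
  refine ⟨?_, ?_, isBlockRun_length_iff.2 fun j hj => ?_⟩
  · simp only [← add_assoc]; omega
  · simp only [← add_assoc]; omega
  · rw [← Nat.cast_add, hxB, ← getD_flatten_take_add hl (hlow i hi) hj]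
    · congr 1
      simp only [hu] at h3 ⊢
      omega
    · have h5 : i * (H + 1) ≤ L * (H + 1) := Nat.mul_le_mul_right _ hi.le
      rw [hN, add_mul]
      beta_reduce
      omega

/-! ### Counting visits along the tiles -/

theorem shift_iterate_apply (n : ℕ) (x : subshift a b) (m : ℤ) :
    ((shift a b)^[n] x).1 m = x.1 (m + n) := by
  induction n generalizing m with
  | zero => simp
  | succ n ih =>
    rw [Function.iterate_succ_apply']
    change ((shift a b)^[n] x).1 (m + 1) = _
    rw [ih]
    exact congrArg x.1 (by push_cast; ring)

open Classical in
/-- If every point that reads `B_K` at the origin visits `G` at least `c` times while it reads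
`B_K`, then every point visits `G` with lower density at least `c / (|B_K| + 1)`. -/
theorem mul_le_card_visits (ha : 1 ≤ a) (hab : a < b) {K c : ℕ} {G : Set (subshift a b)}
    (hG : ∀ x : subshift a b, IsBlockRun a b K x.1 0 (block a b K).length →
      c ≤ ((Finset.range (block a b K).length).filter fun i => (shift a b)^[i] x ∈ G).card)
    (L : ℕ) (x : subshift a b) :
    c * L ≤ ((Finset.range ((L + 1) * ((block a b K).length + 1))).filter
      fun i => (shift a b)^[i] x ∈ G).card := by
  obtain ⟨t, ht0, ht⟩ := exists_tiling ha hab K L x.2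
  set H := (block a b K).length with hH
  have hHpos : 0 < H := length_block_pos hab.le K
  have key : ∀ M ≤ L, t M ≤ H + M * (H + 1) ∧
      c * M ≤ ((Finset.range (t M)).filter fun i => (shift a b)^[i] x ∈ G).card := by
    intro M hM
    induction M with
    | zero => simpa using ht0
    | succ M ih =>
      obtain ⟨ih1, ih2⟩ := ih (by omega)
      obtain ⟨h1, h2, h3⟩ := ht M (by omega)
      refine ⟨by rw [add_mul]; omega, ?_⟩
      have h4 := hG ((shift a b)^[t M] x) fun i hi => by
        have := h3 i hi
        rw [shift_iterate_apply, ← this]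
        exact congrArg x.1 (by ring)
      have hdisj : Disjoint ((Finset.range (t M)).filter fun i => (shift a b)^[i] x ∈ G)
          (((Finset.range H).filter fun i => (shift a b)^[i] ((shift a b)^[t M] x) ∈ G).map
            (addRightEmbedding (t M))) := by
        rw [Finset.disjoint_left]
        intro i hi hi'
        simp only [Finset.mem_map, Finset.mem_filter, Finset.mem_range,
          addRightEmbedding_apply] at hi hi'
        obtain ⟨j, -, rfl⟩ := hi'
        omega
      have hsub : ((Finset.range (t M)).filter fun i => (shift a b)^[i] x ∈ G) ∪
          (((Finset.range H).filter fun i => (shift a b)^[i] ((shift a b)^[t M] x) ∈ G).map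
            (addRightEmbedding (t M))) ⊆
          (Finset.range (t (M + 1))).filter fun i => (shift a b)^[i] x ∈ G := by
        intro i hi
        simp only [Finset.mem_union, Finset.mem_map, Finset.mem_filter, Finset.mem_range,
          addRightEmbedding_apply] at hi ⊢
        rcases hi with hi | ⟨j, ⟨hj, hj'⟩, rfl⟩
        · exact ⟨by omega, hi.2⟩
        · exact ⟨by omega, by rwa [Function.iterate_add_apply]⟩
      have := Finset.card_le_card hsub
      rw [Finset.card_union_of_disjoint hdisj, Finset.card_map] at this
      rw [mul_add, mul_one]
      exact (add_le_add ih2 h4).trans this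
  obtain ⟨h1, h2⟩ := key L le_rfl
  refine h2.trans (Finset.card_le_card (Finset.filter_subset_filter _ fun i hi => ?_))
  simp only [Finset.mem_range] at hi ⊢
  rw [add_mul, one_mul]
  omega

open Classical in
/-- The ergodic estimate behind unique ergodicity: a bound for the visits to `G` along one copy of
`B_K` bounds the measure of `G` for every invariant probability measure. -/
theorem div_le_measureReal (ha : 1 ≤ a) (hab : a < b) {K c : ℕ} {G : Set (subshift a b)}
    (hGm : MeasurableSet G)
    (hG : ∀ x : subshift a b, IsBlockRun a b K x.1 0 (block a b K).length →
      c ≤ ((Finset.range (block a b K).length).filter fun i => (shift a b)^[i] x ∈ G).card)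
    (ν : Measure (subshift a b)) [IsProbabilityMeasure ν]
    (hν : MeasurePreserving (shift a b) ν ν) :
    (c : ℝ) / ((block a b K).length + 1) ≤ ν.real G := by
  set H := (block a b K).length with hH
  have hmeas : ∀ n, MeasurableSet ((shift a b)^[n] ⁻¹' G) := fun n =>
    (hν.iterate n).measurable hGm
  have step : ∀ L : ℕ, (c : ℝ) * L ≤ ((L + 1) * (H + 1)) * ν.real G := by
    intro L
    have h1 : ∀ n, ∫ x, ((shift a b)^[n] ⁻¹' G).indicator (fun _ => (1 : ℝ)) x ∂ν = ν.real G := by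
      intro n
      rw [integral_indicator_const _ (hmeas n), smul_eq_mul, mul_one, measureReal_def,
        (hν.iterate n).measure_preimage hGm.nullMeasurableSet, measureReal_def]
    have hint : ∀ n, Integrable (((shift a b)^[n] ⁻¹' G).indicator (fun _ => (1 : ℝ))) ν :=
      fun n => (integrable_const _).indicator (hmeas n)
    have h2 : ∫ x, ∑ n ∈ Finset.range ((L + 1) * (H + 1)),
        ((shift a b)^[n] ⁻¹' G).indicator (fun _ => (1 : ℝ)) x ∂ν =
        ((L + 1) * (H + 1)) * ν.real G := by
      rw [integral_finsetSum _ fun n _ => hint n]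
      simp [h1]
    rw [← h2]
    have h3 : ∫ _, (c : ℝ) * L ∂ν = c * L := by simp
    rw [← h3]
    refine integral_mono (integrable_const _) (integrable_finsetSum _ fun n _ => hint n) ?_
    intro x
    have h4 := mul_le_card_visits ha hab hG L x
    rw [Finset.card_filter] at h4
    have h5 : ((c * L : ℕ) : ℝ) ≤ _ := Nat.cast_le.2 h4
    push_cast at h5
    refine h5.trans (le_of_eq (Finset.sum_congr rfl fun n _ => ?_))
    simp [Set.indicator_apply]
  rw [div_le_iff₀ (by positivity)]
  have hlim : Tendsto (fun L : ℕ => (c : ℝ) * ((L : ℝ) / (L + 1))) atTop (𝓝 (c * 1)) :=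
    (tendsto_natCast_div_add_atTop (1 : ℝ)).const_mul _
  rw [mul_one] at hlim
  refine le_of_tendsto hlim (Eventually.of_forall fun L => ?_)
  rw [← mul_div_assoc, div_le_iff₀ (by positivity)]
  linarith [step L]

/-! ### Block lengths prime to a given number -/

/-- For every `q`, infinitely many blocks have length prime to `q`: modulo a prime divisor of `b`
the lengths are `1`, and modulo the product `r` of the other prime divisors of `q` the pair
`(|B_k|, b^k)` runs through a periodic orbit of a permutation that starts at `(1, 1)`. -/
theorem exists_coprime_length_block (hab : a ≤ b) {q : ℕ} (hq : 0 < q) (n : ℕ) :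
    ∃ k, n < k ∧ Nat.Coprime (block a b k).length q := by
  set r := ∏ p ∈ q.primeFactors.filter fun p => ¬ p ∣ b, p with hr
  have hrpos : 0 < r := Finset.prod_pos fun p hp =>
    (Nat.prime_of_mem_primeFactors (Finset.mem_filter.1 hp).1).pos
  have : NeZero r := ⟨hrpos.ne'⟩
  have hbr : Nat.Coprime b r := by
    refine Nat.Coprime.prod_right fun p hp => ?_
    rw [Finset.mem_filter] at hp
    exact ((Nat.Prime.coprime_iff_not_dvd (Nat.prime_of_mem_primeFactors hp.1)).2 hp.2).symm
  set β : (ZMod r)ˣ := ZMod.unitOfCoprime b hbr with hβ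
  have hβ' : (β : ZMod r) = (b : ZMod r) := ZMod.coe_unitOfCoprime b hbr
  set f : ZMod r × (ZMod r)ˣ → ZMod r × (ZMod r)ˣ :=
    fun z => ((β * z.2 : (ZMod r)ˣ) * z.1 + 1, β * z.2) with hf
  have hinj : Function.Injective f := by
    rintro ⟨u, c⟩ ⟨v, d⟩ h
    simp only [hf, Prod.mk.injEq] at h
    obtain ⟨h1, h2⟩ := h
    have hcd : c = d := mul_left_cancel h2
    subst hcd
    rw [add_left_inj] at h1
    rw [(Units.mul_right_inj _).1 h1]
  have horbit : ∀ k, f^[k] (1, 1) = (((block a b k).length : ZMod r), β ^ k) := by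
    intro k
    induction k with
    | zero => simp [block]
    | succ k ih =>
      rw [Function.iterate_succ_apply', ih, length_block_succ hab]
      simp [hf, hβ', pow_succ']
  obtain ⟨m, hm, hper⟩ := (Function.Injective.mem_periodicPts hinj ((1, 1) : ZMod r × (ZMod r)ˣ))
  have hk : f^[(n + 1) * m] (1, 1) = (1, 1) := by
    have := (hper.const_mul (n + 1))
    exact this
  rw [horbit] at hk
  have h1 : (((block a b ((n + 1) * m)).length : ℕ) : ZMod r) = ((1 : ℕ) : ZMod r) := by
    simpa using congrArg Prod.fst hk
  refine ⟨(n + 1) * m, by nlinarith, ?_⟩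
  rw [Nat.coprime_iff_gcd_eq_one]
  by_contra hne
  obtain ⟨p, hp, hpd⟩ := Nat.exists_prime_and_dvd hne
  have hp1 := hpd.trans (Nat.gcd_dvd_left _ _)
  have hp2 := hpd.trans (Nat.gcd_dvd_right _ _)
  by_cases hpb : p ∣ b
  · exact Nat.not_coprime_of_dvd_of_dvd hp.one_lt hp1 hpb (coprime_length_block hab _)
  · have hpr : p ∣ r := Finset.dvd_prod_of_mem (fun p => p)
      (Finset.mem_filter.2 ⟨Nat.mem_primeFactors.2 ⟨hp, hp2, hq.ne'⟩, hpb⟩)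
    rw [ZMod.natCast_eq_natCast_iff] at h1
    have h2 := (h1.of_dvd hpr)
    have := (h2.dvd_iff dvd_rfl).1 hp1
    exact hp.one_lt.ne' (Nat.dvd_one.1 this)

/-! ### Cylinders of the full shift -/

theorem isClopen_window_eq (w : List (Fin 2)) (m : ℤ) :
    IsClopen {x : ℤ → Fin 2 | window x m w.length = w} := by
  have : {x : ℤ → Fin 2 | window x m w.length = w} =
      ⋂ i ∈ Finset.range w.length, (fun x : ℤ → Fin 2 => x (m + (i : ℕ))) ⁻¹' {w.getD i 0} := by
    ext x
    simp [window_eq_iff]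
  rw [this]
  exact isClopen_biInter_finset fun i _ => (isClopen_discrete _).preimage (continuous_apply _)

theorem measurableSet_window_eq (w : List (Fin 2)) (m : ℤ) :
    MeasurableSet {x : ℤ → Fin 2 | window x m w.length = w} :=
  (isClopen_window_eq w m).isOpen.measurableSet

theorem measurableSet_subshift (a b : ℕ) : MeasurableSet (subshift a b) := by
  have : (subshift a b)ᶜ = ⋃ m : ℤ, ⋃ w ∈ {w : List (Fin 2) | ∀ k, ¬ w <:+: block a b k},
      {x : ℤ → Fin 2 | window x m w.length = w} := by
    ext x
    simp only [subshift, Set.mem_compl_iff, Set.mem_ofPred_eq, Set.mem_iUnion, not_forall,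
      not_exists, exists_prop]
    constructor
    · rintro ⟨m, l, h⟩
      exact ⟨m, window x m l, h, by simp [window]⟩
    · rintro ⟨m, w, h, hw⟩
      exact ⟨m, w.length, by rwa [hw]⟩
  rw [← MeasurableSet.compl_iff, this]
  exact MeasurableSet.iUnion fun m => MeasurableSet.biUnion (Set.to_countable _)
    fun w _ => measurableSet_window_eq w m

theorem measurableSet_cylinder (w : List (Fin 2)) (j : ℤ) : MeasurableSet (cylinder a b w j) :=
  measurable_subtype_coe (measurableSet_window_eq w j)

/-- A finite measure on the full shift is determined by its values on cylinders. -/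
theorem ext_of_window {μ ν : Measure (ℤ → Fin 2)} [IsFiniteMeasure μ] [IsFiniteMeasure ν]
    (h : ∀ (w : List (Fin 2)) (m : ℤ), μ {x | window x m w.length = w} =
      ν {x | window x m w.length = w}) : μ = ν := by
  have key : ∀ I : Finset ℤ, ν.map I.restrict = μ.map I.restrict := by
    intro I
    obtain ⟨r, hr⟩ : ∃ r : ℕ, ∀ n ∈ I, -(r : ℤ) ≤ n ∧ n < r := by
      refine ⟨I.sup Int.natAbs + 1, fun n hn => ?_⟩
      have := Finset.le_sup (f := Int.natAbs) hn
      omega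
    set π : (ℤ → Fin 2) → (Fin (2 * r) → Fin 2) := fun x i => x (-(r : ℤ) + (i : ℕ)) with hπ
    have hπm : Measurable π := measurable_pi_lambda _ fun i => measurable_pi_apply _
    have h1 : ν.map π = μ.map π := by
      refine Measure.ext_of_singleton fun v => ?_
      rw [Measure.map_apply hπm (measurableSet_singleton v),
        Measure.map_apply hπm (measurableSet_singleton v)]
      have h2 : π ⁻¹' {v} = {x | window x (-(r : ℤ)) (List.ofFn v).length = List.ofFn v} := by
        ext x
        rw [List.length_ofFn]
        simp only [Set.mem_preimage, Set.mem_singleton_iff, Set.mem_ofPred_eq, window]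
        rw [List.ofFn_inj]
      rw [h2, h]
    set g : (Fin (2 * r) → Fin 2) → ((n : I) → Fin 2) :=
      fun v n => v ⟨(n.1 + r).toNat, by have := hr n.1 n.2; omega⟩ with hg
    have hgm : Measurable g := measurable_pi_lambda _ fun i => measurable_pi_apply _
    have h3 : (I.restrict : (ℤ → Fin 2) → ((n : I) → Fin 2)) = g ∘ π := by
      funext x n
      simp only [Finset.restrict, hg, hπ, Function.comp]
      congr 1
      have := hr n.1 n.2
      omega
    rw [h3, ← Measure.map_map hgm hπm, ← Measure.map_map hgm hπm, h1]
  have h4 : IsProjectiveLimit (α := fun _ : ℤ => Fin 2) μ (fun I => μ.map I.restrict) :=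
    fun I => rfl
  have h5 : IsProjectiveLimit (α := fun _ : ℤ => Fin 2) ν (fun I => μ.map I.restrict) := key
  exact h4.unique h5

/-! ### Unique ergodicity -/

theorem shift_iterate_preimage_cylinder (n : ℕ) (w : List (Fin 2)) (j : ℤ) :
    (shift a b)^[n] ⁻¹' cylinder a b w j = cylinder a b w (j + n) := by
  ext x
  simp only [Set.mem_preimage, cylinder, Set.mem_ofPred_eq, window_eq_iff, shift_iterate_apply]
  refine forall₂_congr fun i hi => ?_
  rw [add_right_comm]

theorem measure_cylinder_eq {ν : Measure (subshift a b)}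
    (hν : MeasurePreserving (shift a b) ν ν) (w : List (Fin 2)) (j : ℤ) :
    ν (cylinder a b w j) = ν (cylinder a b w 0) := by
  have h : ∀ (n : ℕ) (i : ℤ), ν (cylinder a b w (i + n)) = ν (cylinder a b w i) := fun n i => by
    rw [← shift_iterate_preimage_cylinder, (hν.iterate n).measure_preimage
      (measurableSet_cylinder w i).nullMeasurableSet]
  obtain ⟨n, rfl | rfl⟩ := j.eq_nat_or_neg
  · rw [← h n 0, zero_add]
  · rw [← h n (-n), neg_add_cancel]

/-- Every invariant probability measure gives a cylinder nearly the density of its name in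
`⋯ B_k B_k B_k ⋯`: along a copy of `B_k`, the two differ only near the end of the copy. -/
theorem abs_measureReal_cylinder_sub_density_le (ha : 1 ≤ a) (hab : a < b)
    (ν : Measure (subshift a b)) [IsProbabilityMeasure ν]
    (hν : MeasurePreserving (shift a b) ν ν) (w : List (Fin 2)) (k : ℕ) :
    |ν.real (cylinder a b w 0) - density a b w k| ≤
      (w.length + 1) / ((block a b k).length + 1) := by
  classical
  set H := (block a b k).length with hH
  have hHpos : 0 < H := length_block_pos hab.le k
  set A := (Finset.range H).filter
    fun i : ℕ => window (periodicBlock a b k) (i : ℤ) w.length = w with hA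
  have hdens : density a b w k = (A.card : ℝ) / H := by
    rw [density]
  -- The positions whose window of length `|w|` may leave the copy of `B_k`.
  set E := Finset.Ico (H - w.length) H with hE
  have hEcard : E.card ≤ w.length := by rw [hE, Nat.card_Ico]; omega
  have hmem : ∀ x : subshift a b, IsBlockRun a b k x.1 0 H → ∀ i < H, i ∉ E →
      ((shift a b)^[i] x ∈ cylinder a b w 0 ↔
        window (periodicBlock a b k) (i : ℤ) w.length = w) := by
    intro x hx i hi hiE
    rw [hE, Finset.mem_Ico] at hiE
    simp only [cylinder, Set.mem_ofPred_eq, window_eq_iff, shift_iterate_apply]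
    refine forall₂_congr fun j hj => ?_
    have := hx (i + j) (by omega)
    rw [← Nat.cast_add, ← this]
    rw [show (0 : ℤ) + (j : ℤ) + (i : ℤ) = 0 + ((i + j : ℕ) : ℤ) by push_cast; ring]
  have hAsub : A ⊆ Finset.range H := Finset.filter_subset _ _
  have hAH : A.card ≤ H := by
    simpa using Finset.card_le_card hAsub
  obtain ⟨G, hG⟩ : ∃ G, G = (cylinder a b w 0)ᶜ := ⟨_, rfl⟩
  have h1 := div_le_measureReal ha hab (K := k) (c := A.card - w.length)
    (measurableSet_cylinder w 0) (fun x hx => by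
      have : A ⊆ ((Finset.range H).filter fun i => (shift a b)^[i] x ∈ cylinder a b w 0) ∪ E := by
        intro i hi
        by_cases hiE : i ∈ E
        · exact Finset.mem_union_right _ hiE
        · rw [hA, Finset.mem_filter, Finset.mem_range] at hi
          refine Finset.mem_union_left _ (Finset.mem_filter.2 ⟨Finset.mem_range.2 hi.1, ?_⟩)
          exact (hmem x hx i hi.1 hiE).2 hi.2
      have := (Finset.card_le_card this).trans (Finset.card_union_le _ _)
      rw [← hH]
      omega) ν hν
  have h2 := div_le_measureReal ha hab (K := k) (c := H - A.card - w.length)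
    (G := G) (by rw [hG]; exact (measurableSet_cylinder w 0).compl) (fun x hx => by
      have : Finset.range H \ A ⊆
          ((Finset.range H).filter fun i => (shift a b)^[i] x ∈ G) ∪ E := by
        intro i hi
        by_cases hiE : i ∈ E
        · exact Finset.mem_union_right _ hiE
        · rw [hA, Finset.mem_sdiff, Finset.mem_filter, Finset.mem_range] at hi
          refine Finset.mem_union_left _ (Finset.mem_filter.2 ⟨Finset.mem_range.2 hi.1, ?_⟩)
          rw [hG, Set.mem_compl_iff, hmem x hx i hi.1 hiE]
          exact fun h => hi.2 ⟨hi.1, h⟩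
      have := (Finset.card_le_card this).trans (Finset.card_union_le _ _)
      rw [Finset.card_sdiff_of_subset hAsub, Finset.card_range] at this
      rw [← hH]
      omega) ν hν
  rw [hG, measureReal_compl (measurableSet_cylinder w 0)] at h2
  simp only [probReal_univ] at h2
  rw [← hH] at h1 h2
  have hc1 : (A.card : ℝ) - w.length ≤ ((A.card - w.length : ℕ) : ℝ) := by
    have : A.card ≤ (A.card - w.length) + w.length := by omega
    have : (A.card : ℝ) ≤ ((A.card - w.length : ℕ) : ℝ) + w.length := by exact_mod_cast this
    linarith
  have hc2 : (H : ℝ) - A.card - w.length ≤ ((H - A.card - w.length : ℕ) : ℝ) := by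
    have : H ≤ (H - A.card - w.length) + w.length + A.card := by omega
    have : (H : ℝ) ≤ ((H - A.card - w.length : ℕ) : ℝ) + w.length + A.card := by exact_mod_cast this
    linarith
  have hHr : (0 : ℝ) < H := by exact_mod_cast hHpos
  have hAr : (A.card : ℝ) ≤ H := by exact_mod_cast hAH
  have hd1 : (A.card : ℝ) / H ≤ 1 := (div_le_one hHr).2 hAr
  have hd2 : (A.card : ℝ) / H * H = A.card := div_mul_cancel₀ _ hHr.ne'
  rw [div_le_iff₀ (by positivity)] at h1 h2
  have hd0 : 0 ≤ (A.card : ℝ) / H := by positivity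
  rw [hdens, abs_le, ← neg_div, div_le_iff₀ (by positivity), le_div_iff₀ (by positivity)]
  constructor <;> nlinarith

theorem tendsto_const_div_length_add_one (hab : a ≤ b) (hb : 2 ≤ b) (c : ℝ) :
    Tendsto (fun k => c / (((block a b k).length : ℝ) + 1)) atTop (𝓝 0) :=
  Tendsto.div_atTop tendsto_const_nhds (tendsto_atTop_add_const_right _ _
    (tendsto_natCast_atTop_atTop.comp (tendsto_length_block hab hb)))

theorem tendsto_density (ha : 1 ≤ a) (hab : a < b) (hb : 2 ≤ b)
    (ν : Measure (subshift a b)) [IsProbabilityMeasure ν]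
    (hν : MeasurePreserving (shift a b) ν ν) (w : List (Fin 2)) (j : ℤ) :
    Tendsto (density a b w) atTop (𝓝 (ν.real (cylinder a b w j))) := by
  rw [measureReal_def, measure_cylinder_eq hν, ← measureReal_def, tendsto_iff_dist_tendsto_zero]
  refine squeeze_zero (fun _ => dist_nonneg) (fun k => ?_)
    (tendsto_const_div_length_add_one hab.le hb (w.length + 1))
  rw [dist_comm]
  exact abs_measureReal_cylinder_sub_density_le ha hab ν hν w k

theorem eq_of_measurePreserving (ha : 1 ≤ a) (hab : a < b) (hb : 2 ≤ b)
    {μ ν : Measure (subshift a b)} [IsProbabilityMeasure μ] [IsProbabilityMeasure ν]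
    (hμ : MeasurePreserving (shift a b) μ μ) (hν : MeasurePreserving (shift a b) ν ν) :
    ν = μ := by
  have hemb := MeasurableEmbedding.subtype_coe (measurableSet_subshift a b)
  have h : ν.map Subtype.val = μ.map Subtype.val := by
    have := Measure.isProbabilityMeasure_map (μ := μ) hemb.measurable.aemeasurable
    have := Measure.isProbabilityMeasure_map (μ := ν) hemb.measurable.aemeasurable
    refine ext_of_window fun w m => ?_
    rw [Measure.map_apply hemb.measurable (measurableSet_window_eq w m),
      Measure.map_apply hemb.measurable (measurableSet_window_eq w m)]
    exact (measureReal_eq_measureReal_iff).1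
      (tendsto_nhds_unique (tendsto_density ha hab hb ν hν w m)
        (tendsto_density ha hab hb μ hμ w m))
  rw [← hemb.comap_map ν, ← hemb.comap_map μ, h]

/-! ### Existence of an invariant measure -/

/-- The left shift on the space of all two-sided sequences. -/
def fullShift (x : ℤ → Fin 2) : ℤ → Fin 2 := fun n => x (n + 1)

theorem continuous_fullShift : Continuous fullShift :=
  continuous_pi fun n => continuous_apply (n + 1)

/-- The uniform distribution on the shift orbit of `⋯ B_k B_k B_k ⋯`. -/
noncomputable def orbitMeasure (a b k : ℕ) : Measure (ℤ → Fin 2) :=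
  ((block a b k).length : ENNReal)⁻¹ • ∑ i ∈ Finset.range (block a b k).length,
    Measure.dirac fun n => periodicBlock a b k (n + (i : ℕ))

theorem isProbabilityMeasure_orbitMeasure (hab : a ≤ b) (k : ℕ) :
    IsProbabilityMeasure (orbitMeasure a b k) := by
  constructor
  have : ((block a b k).length : ENNReal) ≠ 0 := by exact_mod_cast (length_block_pos hab k).ne'
  simp only [orbitMeasure, Measure.smul_apply, Measure.finsetSum_apply, measure_univ,
    Finset.sum_const, Finset.card_range, nsmul_eq_mul, mul_one, smul_eq_mul]
  exact ENNReal.inv_mul_cancel this (ENNReal.natCast_ne_top _)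

theorem map_fullShift_orbitMeasure (hab : a ≤ b) (k : ℕ) :
    (orbitMeasure a b k).map fullShift = orbitMeasure a b k := by
  have hm := continuous_fullShift.measurable
  obtain ⟨H, hH⟩ := Nat.exists_eq_succ_of_ne_zero (length_block_pos hab k).ne'
  rw [orbitMeasure, Measure.map_smul, Measure.map_finset_sum hm.aemeasurable, hH]
  congr 1
  rw [Finset.sum_range_succ, Finset.sum_range_succ']
  congr 1
  · refine Finset.sum_congr rfl fun i _ => ?_
    rw [Measure.map_dirac' hm]
    congr 1
    funext n
    simp only [fullShift]
    congr 1
    push_cast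
    ring
  · rw [Measure.map_dirac' hm]
    congr 1
    funext n
    simp only [fullShift]
    refine Eq.trans ?_ (periodicBlock_add_length k _)
    rw [hH]
    congr 1
    push_cast
    ring

/-- A word that occurs in no block occurs in `⋯ B_k B_k B_k ⋯` only across the boundaries. -/
theorem orbitMeasure_window_le {w : List (Fin 2)} {k : ℕ}
    (hw : ¬ w <:+: block a b k) :
    orbitMeasure a b k {x | window x 0 w.length = w} ≤
      (w.length : ENNReal) / (block a b k).length := by
  classical
  set H := (block a b k).length with hH
  rw [orbitMeasure, Measure.smul_apply, Measure.finsetSum_apply, smul_eq_mul,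
    ENNReal.div_eq_inv_mul]
  refine mul_le_mul_right ?_ _
  have h1 : ∀ i ∈ Finset.range H,
      Measure.dirac (fun n => periodicBlock a b k (n + (i : ℕ))) {x | window x 0 w.length = w} ≤
        if i ∈ Finset.Ico (H - w.length) H then (1 : ENNReal) else 0 := by
    intro i hi
    rw [Finset.mem_range] at hi
    split_ifs with h
    · exact prob_le_one
    · rw [Measure.dirac_apply' _ (measurableSet_window_eq w 0), Set.indicator_of_notMem]
      intro hmem
      rw [Set.mem_ofPred_eq, window_eq_iff] at hmem
      rw [Finset.mem_Ico] at h
      refine hw ⟨(block a b k).take i, (block a b k).drop (i + w.length), ?_⟩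
      have h2 : w = ((block a b k).drop i).take w.length := by
        refine List.ext_getElem (by simp; omega) fun j hj hj' => ?_
        have h3 := hmem j hj
        rw [List.getD_eq_getElem _ _ hj, zero_add, ← Nat.cast_add,
          periodicBlock_natCast_of_lt (by omega), List.getD_eq_getElem _ _ (by omega)] at h3
        rw [← h3, List.getElem_take, List.getElem_drop]
        congr 1
        omega
      conv_lhs => rw [h2]
      rw [List.length_take_of_le (by simp; omega), List.append_assoc, ← List.drop_drop,
        List.take_append_drop, List.take_append_drop]
  refine (Finset.sum_le_sum h1).trans ?_
  rw [Finset.sum_ite_mem, Finset.sum_const, nsmul_eq_mul, mul_one]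
  refine Nat.cast_le.2 ((Finset.card_le_card Finset.inter_subset_right).trans ?_)
  rw [Nat.card_Ico]
  omega

/-- A limit point of the orbit measures of `⋯ B_k B_k B_k ⋯` is an invariant measure carried by
the subshift. -/
theorem exists_invariant_measure (hab : a ≤ b) (hb : 2 ≤ b) :
    ∃ μ : Measure (subshift a b), IsProbabilityMeasure μ ∧
      MeasurePreserving (shift a b) μ μ := by
  set P : ℕ → ProbabilityMeasure (ℤ → Fin 2) := fun k =>
    ⟨orbitMeasure a b k, isProbabilityMeasure_orbitMeasure hab k⟩ with hP
  set U : Ultrafilter ℕ := hyperfilter ℕ with hU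
  set ρ : ProbabilityMeasure (ℤ → Fin 2) := (U.map P).lim with hρ
  have hlim : Tendsto P U (𝓝 ρ) := (U.map P).le_nhds_lim
  have hm := continuous_fullShift.measurable
  have hinv : ρ.map hm.aemeasurable = ρ := by
    refine tendsto_nhds_unique
      (ProbabilityMeasure.tendsto_map_of_tendsto_of_continuous P ρ hlim continuous_fullShift) ?_
    refine hlim.congr fun k => Subtype.ext ?_
    exact (map_fullShift_orbitMeasure hab k).symm
  have hinv' : (ρ : Measure (ℤ → Fin 2)).map fullShift = ρ := congrArg Subtype.val hinv
  have hcyl0 : ∀ w : List (Fin 2), (∀ k, ¬ w <:+: block a b k) →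
      (ρ : Measure (ℤ → Fin 2)) {x | window x 0 w.length = w} = 0 := by
    intro w hw
    have h1 := ProbabilityMeasure.tendsto_measure_of_null_frontier_of_tendsto' hlim
      (E := {x | window x 0 w.length = w}) (by simp [(isClopen_window_eq w 0).frontier_eq])
    refine tendsto_nhds_unique h1 ?_
    have h2 : Tendsto (fun k => (w.length : ENNReal) / (block a b k).length) atTop (𝓝 0) := by
      simp only [div_eq_mul_inv]
      simpa using ENNReal.Tendsto.const_mul (a := (w.length : ENNReal))
        (ENNReal.tendsto_inv_nat_nhds_zero.comp (tendsto_length_block hab hb))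
        (Or.inr (ENNReal.natCast_ne_top _))
    have h3 : Tendsto (fun k => (P k : Measure (ℤ → Fin 2)) {x | window x 0 w.length = w})
        atTop (𝓝 0) :=
      tendsto_of_tendsto_of_tendsto_of_le_of_le tendsto_const_nhds h2 (fun _ => zero_le)
        fun k => orbitMeasure_window_le (hw k)
    exact h3.mono_left ((hyperfilter_le_cofinite).trans Nat.cofinite_eq_atTop.le)
  have hstep : ∀ (w : List (Fin 2)) (m : ℤ),
      (ρ : Measure (ℤ → Fin 2)) {x | window x (m + 1) w.length = w} =
        (ρ : Measure (ℤ → Fin 2)) {x | window x m w.length = w} := by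
    intro w m
    conv_rhs => rw [← hinv', Measure.map_apply hm (measurableSet_window_eq w m)]
    congr 1
    ext x
    simp only [Set.mem_preimage, Set.mem_ofPred_eq, window_eq_iff, fullShift]
    refine forall₂_congr fun i _ => ?_
    rw [add_right_comm]
  have hcyl : ∀ w : List (Fin 2), (∀ k, ¬ w <:+: block a b k) → ∀ m : ℤ,
      (ρ : Measure (ℤ → Fin 2)) {x | window x m w.length = w} = 0 := by
    intro w hw m
    induction m using Int.induction_on with
    | zero => exact hcyl0 w hw
    | succ m ih => rw [hstep, ih]
    | pred m ih => rw [← hstep, sub_add_cancel, ih]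
  have hX : ∀ᵐ x ∂(ρ : Measure (ℤ → Fin 2)), x ∈ subshift a b := by
    have : ∀ m : ℤ, ∀ w ∈ {w : List (Fin 2) | ∀ k, ¬ w <:+: block a b k},
        ∀ᵐ x ∂(ρ : Measure (ℤ → Fin 2)), window x m w.length ≠ w := fun m w hw => by
      rw [ae_iff]
      simpa using hcyl w hw m
    have h2 := ae_all_iff.2 fun m => (ae_ball_iff (Set.to_countable _)).2 (this m)
    filter_upwards [h2] with x hx m l
    by_contra! h
    exact hx m (window x m l) h (by simp [window])
  have hemb := MeasurableEmbedding.subtype_coe (measurableSet_subshift a b)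
  set μ : Measure (subshift a b) := (ρ : Measure (ℤ → Fin 2)).comap Subtype.val with hμ
  have hmap : μ.map Subtype.val = ρ := by
    rw [hμ, hemb.map_comap, Subtype.range_coe_subtype]
    exact Measure.restrict_eq_self_of_ae_mem hX
  refine ⟨μ, ⟨?_⟩, (shift a b).measurable, ?_⟩
  · rw [← Set.preimage_univ (f := Subtype.val), ← Measure.map_apply hemb.measurable .univ, hmap,
      measure_univ]
  · rw [← hemb.comap_map (μ.map (shift a b)), Measure.map_map hemb.measurable
      (shift a b).measurable]
    have : Subtype.val ∘ shift a b = fullShift ∘ Subtype.val := rfl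
    rw [this, ← Measure.map_map hm hemb.measurable, hmap, hinv']

end DelJuncoRudolph

/-! ### A criterion for rank one -/

section RankOne

variable {α : Type*} [MeasurableSpace α]

/-- The measurable set `A` is a union of atoms of the partition of `α` into the levels of the
tower with base `F` and height `h` and the complement of the tower. -/
structure IsTowerSaturated (T : α → α) (F : Set α) (h : ℕ) (A : Set α) : Prop where
  measurableSet : MeasurableSet A
  level : ∀ i < h, T^[i] '' F ⊆ A ∨ T^[i] '' F ⊆ Aᶜ
  compl_tower : (towerUnion T F h)ᶜ ⊆ A ∨ (towerUnion T F h)ᶜ ⊆ Aᶜ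

namespace IsTowerSaturated

variable {T : α → α} {F : Set α} {h : ℕ}

theorem empty : IsTowerSaturated T F h ∅ :=
  ⟨.empty, fun _ _ => Or.inr (by simp), Or.inr (by simp)⟩

theorem compl {A : Set α} (hA : IsTowerSaturated T F h A) : IsTowerSaturated T F h Aᶜ :=
  ⟨hA.1.compl, fun i hi => by simpa [or_comm] using hA.2 i hi, by simpa [or_comm] using hA.3⟩

theorem union {A B : Set α} (hA : IsTowerSaturated T F h A) (hB : IsTowerSaturated T F h B) :
    IsTowerSaturated T F h (A ∪ B) := by
  have key : ∀ L : Set α, (L ⊆ A ∨ L ⊆ Aᶜ) → (L ⊆ B ∨ L ⊆ Bᶜ) → L ⊆ A ∪ B ∨ L ⊆ (A ∪ B)ᶜ := by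
    rintro L (h1 | h1) (h2 | h2)
    · exact Or.inl (h1.trans Set.subset_union_left)
    · exact Or.inl (h1.trans Set.subset_union_left)
    · exact Or.inl (h2.trans Set.subset_union_right)
    · exact Or.inr (by rw [Set.compl_union]; exact Set.subset_inter h1 h2)
  exact ⟨hA.1.union hB.1, fun i hi => key _ (hA.2 i hi) (hB.2 i hi), key _ hA.3 hB.3⟩

theorem biUnion_lt {A : ℕ → Set α} {N : ℕ} (hA : ∀ i < N, IsTowerSaturated T F h (A i)) :
    IsTowerSaturated T F h (⋃ i ∈ Set.Iio N, A i) := by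
  induction N with
  | zero => simpa using empty
  | succ N ih =>
    have : ⋃ i ∈ Set.Iio (N + 1), A i = (⋃ i ∈ Set.Iio N, A i) ∪ A N := by
      ext x
      simp only [Set.mem_iUnion, Set.mem_Iio, Set.mem_union, exists_prop]
      constructor
      · rintro ⟨i, hi, hx⟩
        rcases Nat.lt_succ_iff_lt_or_eq.1 hi with hi | rfl
        exacts [Or.inl ⟨i, hi, hx⟩, Or.inr hx]
      · rintro (⟨i, hi, hx⟩ | hx)
        exacts [⟨i, by omega, hx⟩, ⟨N, by omega, hx⟩]
    rw [this]
    exact (ih fun i hi => hA i (by omega)).union (hA N (by omega))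

/-- Finitely many saturated sets, each close to a piece of a partition, yield a partition that the
tower refines: a point goes to the piece whose index is the greatest `i` with `x ∈ A i`, and
to the first piece if there is none. -/
theorem exists_partition {n : ℕ} [NeZero n] {P A : Fin n → Set α} (hP : IsMeasurablePartition P)
    (hA : ∀ i, IsTowerSaturated T F h (A i)) :
    ∃ P' : Fin n → Set α, IsMeasurablePartition P' ∧ TowerRefines T F h P' ∧
      ∀ i, P i ∆ P' i ⊆ ⋃ j, P j ∆ A j := by
  classical
  set code : α → Fin n → Prop := fun x i => x ∈ A i with hcode
  set g : (Fin n → Prop) → Fin n := fun p => (Finset.univ.filter p).sup id with hg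
  have hgs : ∀ i, g (fun j => j = i) = i := fun i => by
    trans ({i} : Finset (Fin n)).sup id
    · simp only [hg]
      congr 1
      ext j
      simp
    · simp
  have hcm : Measurable code := measurable_pi_lambda _ fun i =>
    measurable_mem.2 (hA i).measurableSet
  have hgm : Measurable g := .of_discrete
  have hrefine : ∀ L : Set α, (∀ i, L ⊆ A i ∨ L ⊆ (A i)ᶜ) → ∃ j, L ⊆ (g ∘ code) ⁻¹' {j} := by
    intro L hL
    rcases L.eq_empty_or_nonempty with rfl | ⟨x, hx⟩
    · exact ⟨0, Set.empty_subset _⟩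
    · refine ⟨g (code x), fun y hy => ?_⟩
      have : code y = code x := by
        funext i
        rcases hL i with h | h
        · exact propext ⟨fun _ => h hx, fun _ => h hy⟩
        · exact propext ⟨fun h' => absurd h' (h hy), fun h' => absurd h' (h hx)⟩
      simp [this]
  refine ⟨fun i => (g ∘ code) ⁻¹' {i}, ⟨fun i => (hgm.comp hcm) (measurableSet_singleton i),
    fun i j hij => ?_, ?_⟩, ⟨fun i hi => hrefine _ fun j => (hA j).level i hi,
    hrefine _ fun j => (hA j).compl_tower⟩, fun i x hx => ?_⟩
  · exact Disjoint.preimage _ (Set.disjoint_singleton.2 hij)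
  · rw [← Set.preimage_iUnion, Set.iUnion_of_singleton, Set.preimage_univ]
  · by_contra hxn
    simp only [Set.mem_iUnion, not_exists, Set.mem_symmDiff, not_or, not_and, not_not] at hxn
    obtain ⟨i₀, hi₀⟩ := Set.mem_iUnion.1 (hP.iUnion_eq ▸ Set.mem_univ x)
    have huniq : ∀ j, x ∈ P j ↔ j = i₀ := fun j => by
      refine ⟨fun hj => ?_, fun hj => hj ▸ hi₀⟩
      by_contra hne
      exact Set.disjoint_left.1 (hP.disjoint hne) hj hi₀
    have hc : code x = fun j => j = i₀ := by
      funext j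
      rw [← huniq j]
      exact propext ⟨(hxn j).2, (hxn j).1⟩
    have : x ∈ P i ↔ x ∈ (g ∘ code) ⁻¹' {i} := by
      rw [huniq, Set.mem_preimage, Function.comp_apply, hc, hgs, Set.mem_singleton_iff, eq_comm]
    rw [Set.mem_symmDiff, this] at hx
    tauto

end IsTowerSaturated

/-- A sequence of towers witnesses rank one as soon as it approximates the sets of a family that
generates the σ-algebra: the approximable sets form a σ-algebra. -/
theorem IsRankOne.of_generateFrom [Nonempty α] {μ : Measure α} [IsFiniteMeasure μ] {T : α → α}
    {F : ℕ → Set α} {h : ℕ → ℕ} {C : Set (Set α)}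
    (hC : ‹MeasurableSpace α› ≤ MeasurableSpace.generateFrom C)
    (htower : ∀ m, IsRokhlinTower T (F m) (h m))
    (hlim : Tendsto (fun m => μ (towerUnion T (F m) (h m))ᶜ) atTop (𝓝 0))
    (happrox : ∀ A ∈ C, ∀ ε : ENNReal, 0 < ε → ∀ᶠ m in atTop,
      ∃ A', IsTowerSaturated T (F m) (h m) A' ∧ μ (A ∆ A') < ε)
    (hCm : ∀ A ∈ C, MeasurableSet A) :
    IsRankOne μ T := by
  have hgen : ∀ A, MeasurableSet A → ∀ ε : ENNReal, 0 < ε → ∀ᶠ m in atTop,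
      ∃ A', IsTowerSaturated T (F m) (h m) A' ∧ μ (A ∆ A') < ε := by
    intro A hA
    refine MeasurableSpace.generateFrom_induction C
      (fun A _ => ∀ ε : ENNReal, 0 < ε → ∀ᶠ m in atTop,
        ∃ A', IsTowerSaturated T (F m) (h m) A' ∧ μ (A ∆ A') < ε)
      (fun A hA _ => happrox A hA) ?_ ?_ ?_ A (hC A hA)
    · exact fun ε hε => Eventually.of_forall fun m => ⟨∅, .empty, by simpa using hε⟩
    · intro A _ ih ε hε
      filter_upwards [ih ε hε] with m ⟨A', hA', hlt⟩
      refine ⟨A'ᶜ, hA'.compl, ?_⟩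
      rwa [compl_symmDiff_compl]
    · intro f hf ih ε hε
      have hle : MeasurableSpace.generateFrom C ≤ ‹MeasurableSpace α› :=
        MeasurableSpace.generateFrom_le hCm
      have hfm : ∀ i, MeasurableSet (f i) := fun i => hle _ (hf i)
      have hε2 : 0 < ε / 2 := ENNReal.half_pos hε.ne'
      set D : ℕ → Set α := fun N => (⋃ i, f i) \ ⋃ i ∈ Set.Iio N, f i with hD
      have hDlim : Tendsto (fun N => μ (D N)) atTop (𝓝 0) := by
        have hanti : Antitone D := fun M N hMN => Set.sdiff_subset_sdiff_right
          (Set.biUnion_subset_biUnion_left (Set.Iio_subset_Iio hMN))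
        have hempty : ⋂ N, D N = ∅ := by
          rw [Set.eq_empty_iff_forall_notMem]
          intro x hx
          rw [Set.mem_iInter] at hx
          obtain ⟨i, hi⟩ := Set.mem_iUnion.1 (hx 0).1
          exact (hx (i + 1)).2 (Set.mem_biUnion (Set.mem_Iio.2 i.lt_succ_self) hi)
        have := tendsto_measure_iInter_atTop (μ := μ) (s := D) (fun N =>
          ((MeasurableSet.iUnion hfm).diff (MeasurableSet.biUnion (Set.to_countable _)
            fun i _ => hfm i)).nullMeasurableSet) hanti ⟨0, measure_ne_top _ _⟩
        rwa [hempty, measure_empty] at this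
      obtain ⟨N, hN⟩ := (hDlim.eventually (gt_mem_nhds hε2)).exists
      obtain ⟨δ, hδ, hδlt⟩ := ENNReal.exists_nnreal_pos_mul_lt
        (ENNReal.natCast_ne_top N) hε2.ne'
      have hall : ∀ᶠ m in atTop, ∀ i ∈ Set.Iio N,
          ∃ A', IsTowerSaturated T (F m) (h m) A' ∧ μ (f i ∆ A') < δ :=
        (eventually_all_finite (Set.finite_Iio N)).2 fun i _ => ih i δ (by exact_mod_cast hδ)
      filter_upwards [hall] with m hm
      choose! A' hA' hlt using hm
      refine ⟨⋃ i ∈ Set.Iio N, A' i, .biUnion_lt hA', ?_⟩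
      have hsub : (⋃ i, f i) ∆ (⋃ i ∈ Set.Iio N, A' i) ⊆
          D N ∪ ⋃ i ∈ Finset.range N, f i ∆ A' i := by
        intro x hx
        by_contra hxn
        simp only [hD, Set.mem_union, Set.mem_sdiff, Set.mem_iUnion, Set.mem_Iio, exists_prop,
          Finset.mem_range, Set.mem_symmDiff, not_or, not_and, not_exists, not_not] at hx hxn
        obtain ⟨h1, h2⟩ := hxn
        rcases hx with ⟨hx, hx'⟩ | ⟨⟨i, hi, hx⟩, hx'⟩
        · obtain ⟨i, hi⟩ := hx
          have h3 : ∃ j, j < N ∧ x ∈ f j := by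
            by_contra! h3
            exact h1 ⟨i, hi⟩ fun j hj => h3 j hj
          obtain ⟨j, hj, hxj⟩ := h3
          exact hx' j hj ((h2 j hj).1 hxj)
        · exact hx' i ((h2 i hi).2 hx)
      calc μ ((⋃ i, f i) ∆ (⋃ i ∈ Set.Iio N, A' i))
          ≤ μ (D N) + ∑ i ∈ Finset.range N, μ (f i ∆ A' i) :=
            (measure_mono hsub).trans ((measure_union_le _ _).trans
              (add_le_add le_rfl (measure_biUnion_finset_le _ _)))
        _ ≤ μ (D N) + ∑ i ∈ Finset.range N, (δ : ENNReal) :=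
            add_le_add le_rfl (Finset.sum_le_sum fun i hi => (hlt i (Finset.mem_range.1 hi)).le)
        _ = μ (D N) + δ * N := by simp [mul_comm]
        _ < ε / 2 + ε / 2 := ENNReal.add_lt_add hN hδlt
        _ = ε := ENNReal.add_halves ε
  refine ⟨F, h, htower, hlim, fun n P hP ε hε => ?_⟩
  have hn : NeZero n := ⟨by
    rintro rfl
    have := hP.iUnion_eq
    rw [Set.iUnion_of_empty] at this
    exact Set.empty_ne_univ this⟩
  obtain ⟨δ, hδ, hδlt⟩ := ENNReal.exists_nnreal_pos_mul_lt
    (ENNReal.mul_ne_top (ENNReal.natCast_ne_top n) (ENNReal.natCast_ne_top n)) hε.ne'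
  have hall : ∀ᶠ m in atTop, ∀ i,
      ∃ A', IsTowerSaturated T (F m) (h m) A' ∧ μ (P i ∆ A') < δ :=
    eventually_all.2 fun i => hgen _ (hP.measurableSet i) δ (by exact_mod_cast hδ)
  filter_upwards [hall] with m hm
  choose A hA hlt using hm
  obtain ⟨P', hP', href, hsub⟩ := IsTowerSaturated.exists_partition hP hA
  refine ⟨P', hP', href, lt_of_le_of_lt ?_ hδlt⟩
  have hone : ∀ i, μ (P i ∆ P' i) ≤ n * δ := fun i =>
    calc μ (P i ∆ P' i) ≤ ∑ j, μ (P j ∆ A j) :=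
          (measure_mono (hsub i)).trans (measure_iUnion_fintype_le _ _)
      _ ≤ ∑ j : Fin n, (δ : ENNReal) := Finset.sum_le_sum fun j _ => (hlt j).le
      _ = n * δ := by simp
  calc ∑ i, μ (P i ∆ P' i) ≤ ∑ i : Fin n, (n * δ : ENNReal) := Finset.sum_le_sum fun i _ => hone i
    _ = δ * (n * n) := by simp; ring

end RankOne

namespace DelJuncoRudolph

variable {a b : ℕ}

/-! ### The towers of the powers of the shift -/

/-- The points of the subshift that read the first `n` letters of `B_k B_k B_k ⋯` from position `s`
on. -/
def runSet (a b k : ℕ) (s : ℤ) (n : ℕ) : Set (subshift a b) :=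
  {x | IsBlockRun a b k x.1 s n}

/-- The base of the `k`-th tower for the `q`-th power of the shift: the points that read
`q + 1` consecutive copies of `B_k` from the origin on. -/
def towerBase (a b q k : ℕ) : Set (subshift a b) :=
  runSet a b k 0 ((q + 1) * (block a b k).length)

theorem measurableSet_coord (n : ℤ) (c : Fin 2) :
    MeasurableSet {x : subshift a b | x.1 n = c} :=
  measurableSet_eq_fun ((measurable_pi_apply n).comp measurable_subtype_coe) measurable_const

theorem measurableSet_runSet (k : ℕ) (s : ℤ) (n : ℕ) : MeasurableSet (runSet a b k s n) := by
  have : runSet a b k s n = ⋂ i ∈ Finset.range n,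
      {x : subshift a b | x.1 (s + (i : ℕ)) = periodicBlock a b k (i : ℕ)} := by
    ext x
    simp [runSet, IsBlockRun]
  rw [this]
  exact Finset.measurableSet_biInter _ fun i _ => measurableSet_coord _ _

theorem shift_iterate_mem_runSet {k : ℕ} {s : ℤ} {n j : ℕ} {x : subshift a b} :
    (shift a b)^[j] x ∈ runSet a b k s n ↔ IsBlockRun a b k x.1 (s + j) n := by
  simp only [runSet, Set.mem_ofPred_eq, IsBlockRun, shift_iterate_apply]
  refine forall₂_congr fun i _ => ?_
  rw [add_right_comm]

theorem shift_iterate_image_runSet (k : ℕ) (s : ℤ) (n j : ℕ) :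
    (shift a b)^[j] '' runSet a b k s n = runSet a b k (s - j) n := by
  ext x
  obtain ⟨y, rfl⟩ := (shift a b).surjective.iterate j x
  rw [((shift a b).injective.iterate j).mem_set_image, shift_iterate_mem_runSet, sub_add_cancel]
  rfl

theorem level_eq (q k i : ℕ) :
    ((shift a b)^[q])^[i] '' towerBase a b q k =
      runSet a b k (-((q * i : ℕ) : ℤ)) ((q + 1) * (block a b k).length) := by
  rw [← Function.iterate_mul, towerBase, shift_iterate_image_runSet, zero_sub]

/-- Distinct levels are disjoint: a common point would read two long runs of `B_k` at a distance
`q * d` with `0 < d < |B_k|`, and `|B_k|` does not divide `q * d`. -/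
theorem isRokhlinTower_towerBase (hab : a ≤ b) {q k : ℕ}
    (hq : Nat.Coprime (block a b k).length q) :
    IsRokhlinTower (shift a b)^[q] (towerBase a b q k) (block a b k).length := by
  refine ⟨length_block_pos hab k, fun i _ => ?_, ?_⟩
  · rw [level_eq]
    exact measurableSet_runSet _ _ _
  · have key : ∀ i j, i < j → j < (block a b k).length → ∀ x : subshift a b,
        x ∈ ((shift a b)^[q])^[i] '' towerBase a b q k →
        x ∈ ((shift a b)^[q])^[j] '' towerBase a b q k → False := by
      intro i j hij hj x hi hj'
      rw [level_eq] at hi hj'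
      have hi' : IsBlockRun a b k x.1 (-((q * j : ℕ) : ℤ) + ((q * (j - i) : ℕ) : ℤ))
          ((q + 1) * (block a b k).length) := by
        have : -((q * j : ℕ) : ℤ) + ((q * (j - i) : ℕ) : ℤ) = -((q * i : ℕ) : ℤ) := by
          push_cast [Nat.cast_sub hij.le]
          ring
        rw [this]
        exact hi
      have hle : q * (j - i) ≤ q * (block a b k).length := Nat.mul_le_mul_left _ (by omega)
      have hdvd := IsBlockRun.length_dvd hab hj' hi' (by rw [add_mul, one_mul]; omega)
      have := Nat.le_of_dvd (by omega) (hq.dvd_of_dvd_mul_left hdvd)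
      omega
    intro i hi j hj hne
    refine Set.disjoint_left.2 fun x hxi hxj => ?_
    rcases lt_or_gt_of_ne hne with h | h
    · exact key i j h hj x hxi hxj
    · exact key j i h hi x hxj hxi

theorem mem_towerUnion_iff {q k : ℕ} {x : subshift a b} :
    x ∈ towerUnion (shift a b)^[q] (towerBase a b q k) (block a b k).length ↔
      ∃ i < (block a b k).length,
        x ∈ runSet a b k (-((q * i : ℕ) : ℤ)) ((q + 1) * (block a b k).length) := by
  simp only [towerUnion, Set.mem_iUnion, Set.mem_Iio, exists_prop, level_eq]

theorem measurableSet_towerUnion (q k : ℕ) :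
    MeasurableSet (towerUnion (shift a b)^[q] (towerBase a b q k) (block a b k).length) := by
  refine MeasurableSet.biUnion (Set.to_countable _) fun i _ => ?_
  rw [level_eq]
  exact measurableSet_runSet _ _ _

/-- Inside a long run of copies of `B_k`, away from its ends, every position belongs to the
tower: the `q`-step walk back from a position meets, within `|B_k|` steps, the start of a copy. -/
theorem shift_iterate_mem_towerUnion (hab : a ≤ b) {q k : ℕ}
    (hq : Nat.Coprime (block a b k).length q) {x : subshift a b} {s i n : ℕ}
    (hx : IsBlockRun a b k x.1 s (n * (block a b k).length))
    (hi : q * (block a b k).length ≤ i)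
    (hi' : i + (q + 1) * (block a b k).length ≤ n * (block a b k).length) :
    (shift a b)^[s + i] x ∈
      towerUnion (shift a b)^[q] (towerBase a b q k) (block a b k).length := by
  set H := (block a b k).length with hH
  have hHpos : 0 < H := length_block_pos hab k
  have : NeZero H := ⟨hHpos.ne'⟩
  obtain ⟨j, hj, hmod⟩ : ∃ j < H, q * j ≡ i [MOD H] := by
    set u : (ZMod H)ˣ := ZMod.unitOfCoprime q hq.symm with hu
    refine ⟨((u⁻¹ : (ZMod H)ˣ) * (i : ZMod H) : ZMod H).val, ZMod.val_lt _, ?_⟩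
    rw [← ZMod.natCast_eq_natCast_iff]
    have hu' : (q : ZMod H) = u := (ZMod.coe_unitOfCoprime q hq.symm).symm
    rw [Nat.cast_mul, ZMod.natCast_zmod_val, hu', Units.mul_inv_cancel_left]
  have hqj : q * j ≤ i := (Nat.mul_le_mul_left q hj.le).trans hi
  obtain ⟨c, hc⟩ := (Nat.modEq_iff_dvd' hqj).1 hmod
  refine mem_towerUnion_iff.2 ⟨j, hj, ?_⟩
  rw [shift_iterate_mem_runSet]
  have h1 := hx.sub (i := c) (m := (q + 1) * H) (by rw [← hH, mul_comm c]; omega)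
  have h2 : -((q * j : ℕ) : ℤ) + ((s + i : ℕ) : ℤ) = (s : ℤ) + c * (H : ℕ) := by
    have : (i : ℤ) = ((q * j : ℕ) : ℤ) + ((H * c : ℕ) : ℤ) := by
      rw [← hc]
      push_cast [Nat.cast_sub hqj]
      ring
    push_cast at this ⊢
    linarith
  rw [h2]
  exact h1

/-- Only the positions near the ends of the two runs of `B_k` in `B_{k+1}` can be outside the
tower, so the tower fills the space up to a proportion of the order of `b^{-(k+1)}`. -/
theorem measureReal_compl_towerUnion_le (ha : 1 ≤ a) (hab : a < b)
    (ν : Measure (subshift a b)) [IsProbabilityMeasure ν]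
    (hν : MeasurePreserving (shift a b) ν ν) {q k : ℕ}
    (hq : Nat.Coprime (block a b k).length q) :
    ν.real (towerUnion (shift a b)^[q] (towerBase a b q k) (block a b k).length)ᶜ ≤
      (4 * q + 4) / (b : ℝ) ^ (k + 1) := by
  classical
  obtain ⟨G, hG⟩ : ∃ G, G =
      towerUnion (shift a b)^[q] (towerBase a b q k) (block a b k).length := ⟨_, rfl⟩
  have hGm : MeasurableSet G := hG ▸ measurableSet_towerUnion q k
  obtain ⟨H, hH⟩ : ∃ H, H = (block a b k).length := ⟨_, rfl⟩
  obtain ⟨H', hH'⟩ : ∃ H', H' = (block a b (k + 1)).length := ⟨_, rfl⟩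
  obtain ⟨M, hM⟩ : ∃ M, M = a * b ^ k * H := ⟨_, rfl⟩
  obtain ⟨N, hN⟩ : ∃ N, N = (b - a) * b ^ k * H := ⟨_, rfl⟩
  have hHpos : 0 < H := hH ▸ length_block_pos hab.le k
  have hlen : H' = M + 1 + N := by
    rw [hH', hM, hN, hH]
    simp [block]
    ring
  have hvisits := div_le_measureReal ha hab (K := k + 1) (c := H' - ((4 * q + 2) * H + 1))
    hGm (fun x hx => by
      obtain ⟨h1, h2⟩ := hx.of_succ
      rw [← hH', hG]
      -- The ends of the two runs of `B_k` and the letter between them.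
      set E := Finset.Ico 0 (q * H) ∪ (Finset.Ico (M - (q + 1) * H) (M + 1 + q * H) ∪
        Finset.Ico (H' - (q + 1) * H) H') with hE
      have hEcard : E.card ≤ (4 * q + 2) * H + 1 := by
        refine (Finset.card_union_le _ _).trans ((add_le_add le_rfl
          (Finset.card_union_le _ _)).trans ?_)
        simp only [Nat.card_Ico]
        have : (4 * q + 2) * H = q * H + q * H + (q + 1) * H + (q + 1) * H := by ring
        omega
      have hsub : Finset.range H' ⊆ ((Finset.range H').filter fun i =>
          (shift a b)^[i] x ∈
            towerUnion (shift a b)^[q] (towerBase a b q k) (block a b k).length) ∪ E := by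
        intro i hi
        by_cases hiE : i ∈ E
        · exact Finset.mem_union_right _ hiE
        refine Finset.mem_union_left _ (Finset.mem_filter.2 ⟨hi, ?_⟩)
        simp only [hE, Finset.mem_union, Finset.mem_Ico, not_or, not_and, not_lt, zero_le,
          true_imp_iff] at hiE
        rw [Finset.mem_range] at hi
        obtain ⟨e1, e2, e3⟩ := hiE
        by_cases hiM : i < M - (q + 1) * H
        · have h3 := shift_iterate_mem_towerUnion hab.le hq (s := 0) (i := i) (n := a * b ^ k)
            (by simpa using h1) (by rwa [← hH]) (by rw [← hH, ← hM]; omega)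
          simpa using h3
        · have e4 := e2 (by omega)
          have e5 : i < H' - (q + 1) * H := by
            by_contra h
            exact absurd (e3 (by omega)) (by omega)
          obtain ⟨j, rfl⟩ := Nat.exists_eq_add_of_le (show M + 1 ≤ i by omega)
          exact shift_iterate_mem_towerUnion hab.le hq (s := M + 1) (i := j)
            (n := (b - a) * b ^ k) (by rw [hM, hH]; simpa using h2) (by rw [← hH]; omega)
            (by rw [← hH, ← hN]; omega)
      have := (Finset.card_le_card hsub).trans (Finset.card_union_le _ _)
      rw [Finset.card_range] at this
      omega) ν hν
  rw [← hG, probReal_compl_eq_one_sub hGm]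
  rw [← hH', div_le_iff₀ (by positivity)] at hvisits
  have hbpos : (0 : ℝ) < (b : ℝ) ^ (k + 1) := by
    have : 0 < b := by omega
    positivity
  rw [le_div_iff₀ hbpos]
  have hc : (H' : ℝ) - ((4 * q + 2) * H + 1) ≤ ((H' - ((4 * q + 2) * H + 1) : ℕ) : ℝ) := by
    have : H' ≤ (H' - ((4 * q + 2) * H + 1)) + ((4 * q + 2) * H + 1) := by omega
    have : (H' : ℝ) ≤ ((H' - ((4 * q + 2) * H + 1) : ℕ) : ℝ) + ((4 * q + 2) * H + 1) := by
      exact_mod_cast this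
    linarith
  have hH1 : (1 : ℝ) ≤ H := by exact_mod_cast hHpos
  have hH'' : (H' : ℝ) = (b : ℝ) ^ (k + 1) * H + 1 := by
    rw [hH', length_block_succ hab.le, ← hH]
    push_cast
    ring
  have hle : 0 ≤ 1 - ν.real G := sub_nonneg.2 measureReal_le_one
  have h5 : (1 - ν.real G) * ((b : ℝ) ^ (k + 1)) * H ≤ (4 * q + 4) * H := by
    have : (1 - ν.real G) * ((b : ℝ) ^ (k + 1) * H) ≤ (1 - ν.real G) * (H' + 1) :=
      mul_le_mul_of_nonneg_left (by linarith) hle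
    nlinarith
  exact le_of_mul_le_mul_right h5 (by linarith)

theorem measure_runSet_eq {ν : Measure (subshift a b)}
    (hν : MeasurePreserving (shift a b) ν ν) (k n j : ℕ) :
    ν (runSet a b k (-(j : ℤ)) n) = ν (runSet a b k 0 n) := by
  rw [← (hν.iterate j).measure_preimage (measurableSet_runSet k (-(j : ℤ)) n).nullMeasurableSet]
  congr 1
  ext x
  rw [Set.mem_preimage, shift_iterate_mem_runSet, neg_add_cancel]
  rfl

theorem measure_towerBase_le (hab : a ≤ b) {ν : Measure (subshift a b)} [IsProbabilityMeasure ν]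
    (hν : MeasurePreserving (shift a b) ν ν) {q k : ℕ}
    (hq : Nat.Coprime (block a b k).length q) :
    ν (towerBase a b q k) ≤ ((block a b k).length : ENNReal)⁻¹ := by
  have ht := isRokhlinTower_towerBase hab hq
  have h1 : ν (⋃ i ∈ Finset.range (block a b k).length,
      ((shift a b)^[q])^[i] '' towerBase a b q k) =
      (block a b k).length * ν (towerBase a b q k) := by
    rw [measure_biUnion_finset (fun i hi j hj => ht.disjoint (by simpa using hi)
      (by simpa using hj)) fun i hi => ht.measurableSet i (Finset.mem_range.1 hi)]
    simp only [level_eq, measure_runSet_eq hν]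
    simp [towerBase]
  have h2 : (block a b k).length * ν (towerBase a b q k) ≤ 1 := h1 ▸ prob_le_one
  rw [mul_comm] at h2
  rwa [ENNReal.le_inv_iff_mul_le]

/-- Up to the complement of the tower and its first `|n|` levels, the letter at position `n` is
constant on each level. -/
theorem exists_saturated_coord (hab : a ≤ b) {ν : Measure (subshift a b)} [IsProbabilityMeasure ν]
    (hν : MeasurePreserving (shift a b) ν ν) {q k : ℕ} (hqpos : 0 < q)
    (hq : Nat.Coprime (block a b k).length q) (n : ℤ) (c : Fin 2) :
    ∃ A', IsTowerSaturated (shift a b)^[q] (towerBase a b q k) (block a b k).length A' ∧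
      ν ({x : subshift a b | x.1 n = c} ∆ A') ≤
        ν (towerUnion (shift a b)^[q] (towerBase a b q k) (block a b k).length)ᶜ +
          n.natAbs * ((block a b k).length : ENNReal)⁻¹ := by
  classical
  have ht := isRokhlinTower_towerBase hab hq
  obtain ⟨H, hH⟩ : ∃ H, H = (block a b k).length := ⟨_, rfl⟩
  set S : Set ℕ := {i | i < H ∧ n.natAbs ≤ i ∧ periodicBlock a b k (n + (q * i : ℕ)) = c} with hS
  set A' : Set (subshift a b) := ⋃ i ∈ S, ((shift a b)^[q])^[i] '' towerBase a b q k with hA'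
  have hletter : ∀ i < H, n.natAbs ≤ i → ∀ x ∈ ((shift a b)^[q])^[i] '' towerBase a b q k,
      x.1 n = periodicBlock a b k (n + (q * i : ℕ)) := by
    intro i hi hni x hx
    rw [level_eq, ← hH] at hx
    have h1 : i ≤ q * i := Nat.le_mul_of_pos_left i hqpos
    have h2 : q * i + q ≤ q * H := by
      have := Nat.mul_le_mul_left q (Nat.succ_le_of_lt hi)
      rwa [Nat.mul_succ] at this
    obtain ⟨j, hj⟩ : ∃ j : ℕ, n + (q * i : ℕ) = j := ⟨(n + (q * i : ℕ)).toNat, by omega⟩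
    have h3 := hx j (by rw [add_mul, one_mul]; omega)
    rw [hj, ← h3]
    exact congrArg x.1 (by omega)
  refine ⟨A', ⟨?_, fun i hi => ?_, Or.inr ?_⟩, ?_⟩
  · exact MeasurableSet.biUnion (Set.to_countable _) fun i hi =>
      ht.measurableSet i (hH ▸ hi.1)
  · by_cases hiS : i ∈ S
    · exact Or.inl (Set.subset_biUnion_of_mem (u := fun i =>
        ((shift a b)^[q])^[i] '' towerBase a b q k) hiS)
    · refine Or.inr fun x hx hxA => ?_
      obtain ⟨j, hj, hxj⟩ := Set.mem_iUnion₂.1 hxA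
      have hne : i ≠ j := fun h => hiS (h ▸ hj)
      exact Set.disjoint_left.1 (ht.disjoint (Set.mem_Iio.2 hi)
        (Set.mem_Iio.2 (hH ▸ hj.1)) hne) hx hxj
  · refine Set.compl_subset_compl.2 fun x hx => ?_
    obtain ⟨j, hj, hxj⟩ := Set.mem_iUnion₂.1 hx
    exact Set.mem_iUnion₂.2 ⟨j, Set.mem_Iio.2 (hH ▸ hj.1), hxj⟩
  · have hsub : {x : subshift a b | x.1 n = c} ∆ A' ⊆
        (towerUnion (shift a b)^[q] (towerBase a b q k) (block a b k).length)ᶜ ∪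
          ⋃ i ∈ Finset.range n.natAbs, ((shift a b)^[q])^[i] '' towerBase a b q k := by
      intro x hx
      by_contra hxn
      rw [Set.mem_union, not_or, Set.mem_compl_iff, not_not] at hxn
      obtain ⟨hxt, hxl⟩ := hxn
      obtain ⟨i, hi, hxi⟩ := Set.mem_iUnion₂.1 hxt
      rw [Set.mem_Iio, ← hH] at hi
      have hni : n.natAbs ≤ i := by
        by_contra! h
        exact hxl (Set.mem_iUnion₂.2 ⟨i, Finset.mem_range.2 h, hxi⟩)
      rcases hx with ⟨hxc, hxA⟩ | ⟨hxA, hxc⟩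
      · refine hxA (Set.mem_iUnion₂.2 ⟨i, ⟨hi, hni, ?_⟩, hxi⟩)
        rw [← hletter i hi hni x hxi]
        exact hxc
      · obtain ⟨j, hj, hxj⟩ := Set.mem_iUnion₂.1 hxA
        exact hxc ((hletter j hj.1 hj.2.1 x hxj).trans hj.2.2)
    refine (measure_mono hsub).trans ((measure_union_le _ _).trans (add_le_add le_rfl ?_))
    refine (measure_biUnion_finset_le _ _).trans ?_
    have : ∀ i ∈ Finset.range n.natAbs, ν (((shift a b)^[q])^[i] '' towerBase a b q k) ≤
        ((block a b k).length : ENNReal)⁻¹ := fun i _ => by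
      rw [level_eq, measure_runSet_eq hν]
      exact measure_towerBase_le hab hν hq
    refine (Finset.sum_le_sum this).trans (le_of_eq ?_)
    simp

theorem measurableSpace_le_generateFrom_coord :
    (inferInstance : MeasurableSpace (subshift a b)) ≤ MeasurableSpace.generateFrom
      {A : Set (subshift a b) | ∃ n c, A = {x : subshift a b | x.1 n = c}} := by
  intro A hA
  obtain ⟨A', hA', rfl⟩ := hA
  have : @Measurable _ _ (MeasurableSpace.generateFrom
      {A : Set (subshift a b) | ∃ n c, A = {x : subshift a b | x.1 n = c}}) _
      (Subtype.val : subshift a b → ℤ → Fin 2) := by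
    let _ := MeasurableSpace.generateFrom
      {A : Set (subshift a b) | ∃ n c, A = {x : subshift a b | x.1 n = c}}
    refine measurable_pi_lambda _ fun n => measurable_to_countable' fun c => ?_
    exact MeasurableSpace.measurableSet_generateFrom ⟨n, c, rfl⟩
  exact this hA'

theorem isTotallyRankOne_shift (ha : 1 ≤ a) (hab : a < b) (hb : 2 ≤ b)
    (μ : Measure (subshift a b)) [IsProbabilityMeasure μ]
    (hμ : MeasurePreserving (shift a b) μ μ) : IsTotallyRankOne μ (shift a b) := by
  intro q hq
  choose k hk hcop using exists_coprime_length_block (a := a) hab.le hq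
  have hktop : Tendsto k atTop atTop := tendsto_atTop_mono (fun n => (hk n).le) tendsto_id
  have : Nonempty (subshift a b) := nonempty_of_isProbabilityMeasure μ
  have hlim : Tendsto (fun m => μ (towerUnion (shift a b)^[q] (towerBase a b q (k m))
      (block a b (k m)).length)ᶜ) atTop (𝓝 0) := by
    rw [← ENNReal.tendsto_toReal_iff (fun _ => measure_ne_top _ _) ENNReal.zero_ne_top]
    have hpow : Tendsto (fun k : ℕ => (4 * q + 4) / (b : ℝ) ^ (k + 1)) atTop (𝓝 0) :=
      Tendsto.div_atTop tendsto_const_nhds ((tendsto_pow_atTop_atTop_of_one_lt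
        (by exact_mod_cast hb)).comp (tendsto_add_atTop_nat 1))
    exact squeeze_zero (fun _ => ENNReal.toReal_nonneg)
      (fun m => measureReal_compl_towerUnion_le ha hab μ hμ (hcop m)) (hpow.comp hktop)
  refine IsRankOne.of_generateFrom measurableSpace_le_generateFrom_coord
    (fun m => isRokhlinTower_towerBase hab.le (hcop m)) hlim ?_ ?_
  · rintro _ ⟨n, c, rfl⟩ ε hε
    have hlen := (tendsto_length_block (a := a) hab.le hb).comp hktop
    have h1 : Tendsto (fun m => (n.natAbs : ENNReal) *
        ((block a b (k m)).length : ENNReal)⁻¹) atTop (𝓝 0) := by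
      simpa using ENNReal.Tendsto.const_mul (a := (n.natAbs : ENNReal))
        (ENNReal.tendsto_inv_nat_nhds_zero.comp hlen) (Or.inr (ENNReal.natCast_ne_top _))
    have h2 := hlim.add h1
    rw [add_zero] at h2
    filter_upwards [h2.eventually (gt_mem_nhds hε)] with m hm
    obtain ⟨A', hA', hle⟩ := exists_saturated_coord hab.le hμ hq (hcop m) n c
    exact ⟨A', hA', hle.trans_lt hm⟩
  · rintro _ ⟨n, c, rfl⟩
    exact measurableSet_coord n c

end DelJuncoRudolph

theorem mainTheorem1 (a b : ℕ) (ha : 1 ≤ a) (hab : a ≤ b - 1) (hb : 2 ≤ b) :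
    ∃ μ : Measure (DelJuncoRudolph.subshift a b),
      IsProbabilityMeasure μ ∧
      (∀ (w : List (Fin 2)) (j : ℤ),
        Tendsto (DelJuncoRudolph.density a b w) atTop
          (𝓝 (μ.real (DelJuncoRudolph.cylinder a b w j)))) ∧
      MeasurePreserving (DelJuncoRudolph.shift a b) μ μ ∧
      (∀ ν : Measure (DelJuncoRudolph.subshift a b), IsProbabilityMeasure ν →
        MeasurePreserving (DelJuncoRudolph.shift a b) ν ν → ν = μ) ∧
      IsTotallyRankOne μ (DelJuncoRudolph.shift a b) := by
  have hab' : a < b := by omega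
  obtain ⟨μ, hμ, hinv⟩ := DelJuncoRudolph.exists_invariant_measure hab'.le hb
  exact ⟨μ, hμ, DelJuncoRudolph.tendsto_density ha hab' hb μ hinv, hinv,
    fun ν _ hν => DelJuncoRudolph.eq_of_measurePreserving ha hab' hb hinv hν,
    DelJuncoRudolph.isTotallyRankOne_shift ha hab' hb μ hinv⟩
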